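/- Let $\alpha\in\mathbb R$ and let $z>y\ge 1$ be integers. In the $(\alpha,z,y)$-Johnson Coverage problem the input is a finite universe $U=\{1,\dots,m\}$, a nonempty collection $E$ of $z$-element subsets of $U$, and an integer $k\ge 0$; the task is to distinguish between (Completeness) there are $y$-element sets $S_1,\dots,S_k\subseteq U$ such that every $T\in E$ contains some $S_i$; and (Soundness) for all $y$-element sets $S_1,\dots,S_k\subseteq U$, at most $\alpha|E|$ of the sets $T\in E$ contain some $S_i$. $(\alpha,z,y)$-Johnson Coverage$^*$ is its restriction to instances with $|E|=\omega(k\,|U|^{z-y-1})$; it is NP-hard if for some function $w:\mathbb N\to\mathbb R$ with $w(m)\to\infty$ the problem is NP-hard on the instances with $|E|\ge w(|U|)\cdot k\,|U|^{z-y-1}$. NP-hardness of a promise problem means that every language in NP has a polynomial-time many-one reduction to it. $\|a-b\|_0$ denotes the Hamming distance, and $\log$ the natural logarithm. Assume that $(\alpha,z,y)$-Johnson Coverage$^*$ is NP-hard. Then for every constant $\varepsilon>0$ the following two statements hold. (k-median) There are constants $D\in\mathbb R$ and $\rho>0$ such that, given a point set $\mathcal P\subseteq\{0,1\}^d$ of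 size $n\ge 2$ with $d\le D\log n$ and an integer $k\ge 0$, it is NP-hard to distinguish between the following two cases: Completeness: there exist $\mathcal C'=\{c_1,\dots,c_k\}\subseteq\{0,1\}^d$ and $\sigma:\mathcal P\to\mathcal C'$ with $\sum_{a\in\mathcal P}\|a-\sigma(a)\|_0\le \rho\, n\log n$; Soundness: for all $\mathcal C'=\{c_1,\dots,c_k\}\subseteq\{0,1\}^d$ and all $\sigma:\mathcal P\to\mathcal C'$, $$\sum_{a\in\mathcal P}\|a-\sigma(a)\|_0\ \ge\ \Bigl(1+\frac{1-\alpha}{z-y}-\varepsilon\Bigr)\rho\, n\log n .$$ (k-means) There are constants $D\in\mathbb R$ and $\rho>0$ such that, given a point set $\mathcal P\subseteq\{0,1\}^d$ of size $n\ge 2$ with $d\le D\log n$ and an integer $k\ge 0$, it is NP-hard to distinguish between the following two cases: Completeness: there exist $\mathcal C'=\{c_1,\dots,c_k\}\subseteq\{0,1\}^d$ and $\sigma:\mathcal P\to\mathcal C'$ with $\sum_{a\in\mathcal P}\|a-\sigma(a)\|_0^2\le \rho\, n(\log n)^2$; Soundness: for all $\mathcal C'=\{c_1,\dots,c_k\}\subseteq\{0,1\}^d$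 and all $\sigma:\mathcal P\to\mathcal C'$, $$\sum_{a\in\mathcal P}\|a-\sigma(a)\|_0^2\ \ge\ \Bigl(1+\frac{(1-\alpha)(2(z-y)+1)}{(z-y)^2}-\varepsilon\Bigr)\rho\, n(\log n)^2 .$$ -/

import Mathlib

namespace JohnsonClustering

/-! ### Polynomial time and NP-hardness -/

/-- Programs of a machine with finitely many stacks over the alphabet `Bool` (a program mentions
finitely many of the stacks, which are indexed by `ℕ`). Every elementary instruction reads or
writes one symbol at the top of one stack, exactly as a multitape Turing machine does when a tape
is split at the head into two stacks; the finite control is written in structured form. -/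
inductive StackProg : Type
  /-- Do nothing. -/
  | skip : StackProg
  /-- Push the symbol `b` on stack `r`. -/
  | push (r : ℕ) (b : Bool) : StackProg
  /-- Remove the top symbol of stack `r`, if there is one. -/
  | pop (r : ℕ) : StackProg
  /-- Run `p`, then `q`. -/
  | seq (p q : StackProg) : StackProg
  /-- Branch on whether stack `r` is empty, has `false` on top, or has `true` on top. -/
  | branch (r : ℕ) (pNil pFalse pTrue : StackProg) : StackProg
  /-- Run `p` repeatedly, as long as stack `r` is not empty. -/
  | loop (r : ℕ) (p : StackProg) : StackProg

/-- The contents of all stacks; the head of a list is the top of the stack. -/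
abbrev Store : Type := ℕ → List Bool

/-- `Runs p s s' t`: started on `s`, the program `p` halts with `s'` after exactly `t` steps. Every
instruction and every test of a stack is one step. -/
inductive Runs : StackProg → Store → Store → ℕ → Prop
  | skip (s : Store) : Runs .skip s s 1
  | push (r : ℕ) (b : Bool) (s : Store) :
      Runs (.push r b) s (Function.update s r (b :: s r)) 1
  | pop (r : ℕ) (s : Store) : Runs (.pop r) s (Function.update s r (s r).tail) 1
  | seq {p q : StackProg} {s s' s'' : Store} {t t' : ℕ} :
      Runs p s s' t → Runs q s' s'' t' → Runs (.seq p q) s s'' (t + t')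
  | branchNil {r : ℕ} {p₀ p₁ p₂ : StackProg} {s s' : Store} {t : ℕ} :
      s r = [] → Runs p₀ s s' t → Runs (.branch r p₀ p₁ p₂) s s' (t + 1)
  | branchFalse {r : ℕ} {p₀ p₁ p₂ : StackProg} {s s' : Store} {t : ℕ} :
      (s r).head? = some false → Runs p₁ s s' t → Runs (.branch r p₀ p₁ p₂) s s' (t + 1)
  | branchTrue {r : ℕ} {p₀ p₁ p₂ : StackProg} {s s' : Store} {t : ℕ} :
      (s r).head? = some true → Runs p₂ s s' t → Runs (.branch r p₀ p₁ p₂) s s' (t + 1)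
  | loopDone {r : ℕ} {p : StackProg} {s : Store} :
      s r = [] → Runs (.loop r p) s s 1
  | loopStep {r : ℕ} {p : StackProg} {s s' s'' : Store} {t t' : ℕ} :
      s r ≠ [] → Runs p s s' t → Runs (.loop r p) s' s'' t' →
        Runs (.loop r p) s s'' (t + t' + 1)

/-- The initial store: `x` on stack `0`, `w` on stack `1`, all other stacks empty. -/
def initStore (x w : List Bool) : Store := fun r =>
  if r = 0 then x else if r = 1 then w else []

/-- `f` is computable in polynomial time: input and output are on stack `0`. -/
def PolyTimeComputable (f : List Bool → List Bool) : Prop :=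
  ∃ (p : StackProg) (b : Polynomial ℕ), ∀ x : List Bool,
    ∃ (s : Store) (t : ℕ), Runs p (initStore x []) s t ∧ s 0 = f x ∧ t ≤ b.eval x.length

/-- The class NP: `L` has certificates `w` of polynomial length (given on stack `1`) that are
checked in polynomial time; the verifier accepts by leaving exactly `true` on stack `0`. -/
def InNP (L : Set (List Bool)) : Prop :=
  ∃ (V : StackProg) (c b : Polynomial ℕ), ∀ x : List Bool,
    (∀ w : List Bool, w.length ≤ c.eval x.length →
      ∃ (s : Store) (t : ℕ), Runs V (initStore x w) s t ∧ t ≤ b.eval x.length) ∧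
    (x ∈ L ↔ ∃ w : List Bool, w.length ≤ c.eval x.length ∧
      ∃ (s : Store) (t : ℕ), Runs V (initStore x w) s t ∧ s 0 = [true])

/-- The problem of distinguishing the inputs in `yes` from the inputs in `no`. -/
structure PromiseProblem where
  yes : Set (List Bool)
  no : Set (List Bool)

/-- Every language in NP has a polynomial-time many-one reduction to the promise problem. -/
def NPHard (Q : PromiseProblem) : Prop :=
  ∀ L : Set (List Bool), InNP L →
    ∃ f : List Bool → List Bool, PolyTimeComputable f ∧
      (∀ x ∈ L, f x ∈ Q.yes) ∧ (∀ x ∉ L, f x ∈ Q.no)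

/-! ### Encoding of instances -/

/-- A number in unary, with an end mark. -/
def encodeUnary (m : ℕ) : List Bool := List.replicate m true ++ [false]

/-- A bit string in self-delimiting form: each bit is preceded by `true`, the end is `false`. -/
def encodeRow (l : List Bool) : List Bool := l.flatMap (fun b => [true, b]) ++ [false]

/-- The string that encodes two numbers and a list of 0/1 vectors of length `m`. -/
def encodeInput (m k : ℕ) (rows : List (Fin m → Bool)) : List Bool :=
  encodeUnary m ++ encodeUnary k ++ rows.flatMap (fun v => encodeRow (List.ofFn v))

/-! ### Johnson Coverage -/

/-- An input `(U, E, k)` with `U = Fin n`. -/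
structure CoverageInstance where
  n : ℕ
  E : Finset (Finset (Fin n))
  k : ℕ

/-- `x` encodes `I`: it lists `n`, `k` and the characteristic vectors of the members of `E`, each
once, in some order. -/
def CoverageInstance.EncodedBy (I : CoverageInstance) (x : List Bool) : Prop :=
  ∃ l : List (Finset (Fin I.n)), l.Nodup ∧ l.toFinset = I.E ∧
    x = encodeInput I.n I.k (l.map fun T i => decide (i ∈ T))

/-- `cov(S, E)`, the members of `E` that contain `S`. -/
def cov {n : ℕ} (S : Finset (Fin n)) (E : Finset (Finset (Fin n))) : Finset (Finset (Fin n)) :=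
  E.filter fun T => S ⊆ T

/-- `cov(S₁, E) ∪ ⋯ ∪ cov(S_k, E)`. -/
def covUnion {n k : ℕ} (S : Fin k → Finset (Fin n)) (E : Finset (Finset (Fin n))) :
    Finset (Finset (Fin n)) :=
  Finset.univ.biUnion fun i => cov (S i) E

/-- The inputs of `(z, y)`-Johnson Coverage whose density is at least `ω`: a nonempty collection
`E` of `z`-sets with `|E| ≥ ω(|U|) · k · |U|^(z-y-1)`. -/
def CoverageInstance.Dense (I : CoverageInstance) (z y : ℕ) (ω : ℕ → ℝ) : Prop :=
  I.E.Nonempty ∧ (∀ T ∈ I.E, T.card = z) ∧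
    ω I.n * ((I.k : ℝ) * (I.n : ℝ) ^ (z - y - 1)) ≤ (I.E.card : ℝ)

/-- Some `k` sets of size `y` cover all of `E`. -/
def CoverageInstance.Complete (I : CoverageInstance) (y : ℕ) : Prop :=
  ∃ S : Fin I.k → Finset (Fin I.n), (∀ i, (S i).card = y) ∧ covUnion S I.E = I.E

/-- Any `k` sets of size `y` cover at most an `α` fraction of `E`. -/
def CoverageInstance.Sound (I : CoverageInstance) (α : ℝ) (y : ℕ) : Prop :=
  ∀ S : Fin I.k → Finset (Fin I.n), (∀ i, (S i).card = y) →
    ((covUnion S I.E).card : ℝ) ≤ α * (I.E.card : ℝ)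

/-- `(α, z, y)`-Johnson Coverage on the inputs of density at least `ω`. -/
def johnsonCoverage (α : ℝ) (z y : ℕ) (ω : ℕ → ℝ) : PromiseProblem where
  yes := {x | ∃ I : CoverageInstance, I.EncodedBy x ∧ I.Dense z y ω ∧ I.Complete y}
  no := {x | ∃ I : CoverageInstance, I.EncodedBy x ∧ I.Dense z y ω ∧ I.Sound α y}

/-- `(α, z, y)`-Johnson Coverage* is NP-hard: `(α, z, y)`-Johnson Coverage is NP-hard on instances
with `|E| = ω(k · |U|^(z-y-1))`. -/
def JohnsonCoverageStarNPHard (α : ℝ) (z y : ℕ) : Prop :=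
  ∃ ω : ℕ → ℝ, Filter.Tendsto ω Filter.atTop Filter.atTop ∧ NPHard (johnsonCoverage α z y ω)

/-! ### Continuous clustering in the Hamming metric -/

/-- A point set `P ⊆ {0,1}^d` and a number `k` of centers. -/
structure ClusteringInstance where
  d : ℕ
  P : Finset (Fin d → Bool)
  k : ℕ

/-- `x` encodes `I`: it lists `d`, `k` and the members of `P`, each once, in some order. -/
def ClusteringInstance.EncodedBy (I : ClusteringInstance) (x : List Bool) : Prop :=
  ∃ l : List (Fin I.d → Bool), l.Nodup ∧ l.toFinset = I.P ∧ x = encodeInput I.d I.k l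

/-- The cost `∑_{a ∈ P} ‖a - σ(a)‖₀ ^ t`, where `c` lists the centers and `σ` assigns to every point
the index of its center: the `k`-median cost for `t = 1` and the `k`-means cost for `t = 2`. -/
def ClusteringInstance.cost (I : ClusteringInstance) (t : ℕ) (c : Fin I.k → (Fin I.d → Bool))
    (σ : {a // a ∈ I.P} → Fin I.k) : ℝ :=
  ∑ a : {a // a ∈ I.P}, (hammingDist a.1 (c (σ a)) : ℝ) ^ t

/-- At least two points (so that `log |P| > 0`), in dimension at most `D log |P|`. -/
def ClusteringInstance.LogDim (I : ClusteringInstance) (D : ℝ) : Prop :=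
  2 ≤ I.P.card ∧ (I.d : ℝ) ≤ D * Real.log I.P.card

/-- With `n = |P|`, the problem of distinguishing whether the cost is at most `ρ n (log n)^t` for
some choice of `k` centers in `{0,1}^d`, or at least `γ ρ n (log n)^t` for every choice, on point
sets in `{0,1}^d` with `d ≤ D log n`. -/
noncomputable def hammingClusteringGap (t : ℕ) (D ρ γ : ℝ) : PromiseProblem where
  yes := {x | ∃ I : ClusteringInstance, I.EncodedBy x ∧ I.LogDim D ∧
    ∃ (c : Fin I.k → (Fin I.d → Bool)) (σ : {a // a ∈ I.P} → Fin I.k),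
      I.cost t c σ ≤ ρ * I.P.card * Real.log I.P.card ^ t}
  no := {x | ∃ I : ClusteringInstance, I.EncodedBy x ∧ I.LogDim D ∧
    ∀ (c : Fin I.k → (Fin I.d → Bool)) (σ : {a // a ∈ I.P} → Fin I.k),
      γ * (ρ * I.P.card * Real.log I.P.card ^ t) ≤ I.cost t c σ}

end JohnsonClustering

/-! Each element `u` of the universe receives a binary word of weight `M * g`, any two words sharing
at most `g` ones; a set `T` becomes the union of the words of its elements. Here `M` is a large
constant and `g` is of order `log m`. If a `y`-set `S` lies in the `z`-set `T`, their images differ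
in at most `(z - y) * M * g` places, so a cover by `y`-sets yields good centers. Conversely, the
images of `T` and `T'` are at distance at least `2 * (z - |T ∩ T'|) * L` with `L = (M - 2 * z) * g`.

For soundness, write `w = z - y` and consider one center. By the triangle inequality, the sets
within distance less than `w * L` of it meet pairwise in at least `y + 1` elements, so there are
only `O(m ^ (z - y - 1))` of them. The sets within distance less than `(w + 1) * L` meet pairwise in
at least `y` elements: either they share a `y`-set, or again there are only `O(m ^ (z - y - 1))` of
them (`common_subset_or_card_le`). The density hypothesis makes both exceptional families negligible
even when summed over the `k` centers. Hence, up to a small error, at most an `α` fraction of the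
points pays about `(w * L) ^ t` and all others pay at least `((w + 1) * L) ^ t` (`layer_cost_ge`),
against `(w * M * g) ^ t` per point in the complete case, up to lower order terms in `M`. The ratio
tends to `1 + (1 - α) * R` with `w ^ t * R = (w + 1) ^ t - w ^ t`, which is the claimed factor for
`t = 1` and `t = 2`.

To tie the cost to `log n`, every point is repeated with all `2 ^ g` tags of `g` bits. A tag changes
distances by at most `g`, negligible against `M * g`, while `log n` is forced between `g * log 2`
and `(1 + z / M) * g * log 2`. The words come from a greedy Gilbert-Varshamov argument over an
alphabet of size `2 ^ (M + 1)` (`greedy_spec`); all candidates can be listed, since there are only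
polynomially many.

Two degenerate cases remain. Instances with a small universe, where the density is not yet
effective, are answered from a finite table. If `α ≥ 1`, the factor is at most `1` and a single
instance lies on both sides of the gap. Polynomial time is obtained from closure properties of the
class `PT` of functions between encoded types. -/

namespace JohnsonClustering

/-! ### Stores given by a list, relocation of programs -/

/-- The store whose first stacks are the members of `l`; the other stacks are empty. -/
def st (l : List (List Bool)) : Store := fun i => l.getD i []

theorem initStore_nil (x : List Bool) : initStore x [] = st [x] := by
  funext i
  rcases i with _ | _ | i <;> simp [initStore, st]

theorem update_st {l : List (List Bool)} {r : ℕ} (h : r < l.length) (v : List Bool) :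
    Function.update (st l) r v = st (l.set r v) := by
  funext i
  by_cases hi : i = r
  · subst hi; simp [st, h]
  · simp [st, Function.update_of_ne hi, List.getElem?_set_ne (Ne.symm hi)]

theorem st_append_nil (l : List (List Bool)) : st (l ++ [[]]) = st l := by
  funext i
  simp only [st, List.getD_eq_getElem?_getD, List.getElem?_append]
  split_ifs with h
  · rfl
  · rw [List.getElem?_eq_none (by omega : l.length ≤ i)]
    cases i - l.length <;> simp

/-- `s` placed above the first `K` stacks of `u`. -/
def glue (K : ℕ) (u s : Store) : Store := fun i => if i < K then u i else s (i - K)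

theorem glue_update (K : ℕ) (u s : Store) (r : ℕ) (v : List Bool) :
    glue K u (Function.update s r v) = Function.update (glue K u s) (r + K) v := by
  funext i
  by_cases h : i < K
  · have : i ≠ r + K := by omega
    simp [glue, h, Function.update_of_ne this]
  · by_cases h' : i = r + K
    · subst h'; simp [glue]
    · have : i - K ≠ r := by omega
      simp [glue, h, Function.update_of_ne this, Function.update_of_ne h']

theorem glue_apply (K : ℕ) (u s : Store) (r : ℕ) : glue K u s (r + K) = s r := by
  simp [glue]

theorem st_append (l l' : List (List Bool)) : st (l ++ l') = glue l.length (st l) (st l') := by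
  funext i
  simp only [st, glue, List.getD_eq_getElem?_getD, List.getElem?_append]
  split_ifs <;> rfl

/-- The program `p` with all its stacks moved up by `K`. -/
def StackProg.shift (K : ℕ) : StackProg → StackProg
  | .skip => .skip
  | .push r b => .push (r + K) b
  | .pop r => .pop (r + K)
  | .seq p q => .seq (p.shift K) (q.shift K)
  | .branch r p q s => .branch (r + K) (p.shift K) (q.shift K) (s.shift K)
  | .loop r p => .loop (r + K) (p.shift K)

/-- Programs are written for the lowest stacks; relocation turns them into subroutines that run
while the data of the caller rests on the stacks below. -/
theorem Runs.shift {p : StackProg} {s s' : Store} {t : ℕ} (h : Runs p s s' t) (K : ℕ) (u : Store) :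
    Runs (p.shift K) (glue K u s) (glue K u s') t := by
  induction h with
  | skip s => exact .skip _
  | push r b s =>
    rw [glue_update, ← glue_apply K u s r]
    exact .push _ _ _
  | pop r s =>
    rw [glue_update, ← glue_apply K u s r]
    exact .pop _ _
  | seq _ _ ih₁ ih₂ => exact .seq ih₁ ih₂
  | branchNil h _ ih => exact .branchNil (by rwa [glue_apply]) ih
  | branchFalse h _ ih => exact .branchFalse (by rwa [glue_apply]) ih
  | branchTrue h _ ih => exact .branchTrue (by rwa [glue_apply]) ih
  | loopDone h => exact .loopDone (by rwa [glue_apply])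
  | loopStep h _ _ ih₁ ih₂ => exact .loopStep (by rwa [glue_apply]) ih₁ ih₂

/-- A step pushes at most one symbol. This bounds outputs, which makes polynomial time closed under
composition, and it bounds the leftovers on work stacks. -/
theorem Runs.length_le {p : StackProg} {s s' : Store} {t : ℕ} (h : Runs p s s' t) (r : ℕ) :
    (s' r).length ≤ (s r).length + t := by
  induction h with
  | skip s => omega
  | push r' b s =>
    by_cases hr : r = r'
    · subst hr; simp
    · simp [Function.update_of_ne hr]
  | pop r' s =>
    by_cases hr : r = r'
    · subst hr; simp; omega
    · simp [Function.update_of_ne hr]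
  | seq _ _ ih₁ ih₂ => omega
  | branchNil h _ ih => omega
  | branchFalse h _ ih => omega
  | branchTrue h _ ih => omega
  | loopDone h => omega
  | loopStep h _ _ ih₁ ih₂ => omega

/-- `p` leads from `s` to `s'` in at most `T` steps. -/
def RunsLe (p : StackProg) (s s' : Store) (T : ℕ) : Prop := ∃ t ≤ T, Runs p s s' t

theorem RunsLe.mono {p : StackProg} {s s' : Store} {T T' : ℕ} (h : RunsLe p s s' T) (hT : T ≤ T') :
    RunsLe p s s' T' := by
  obtain ⟨t, ht, h⟩ := h
  exact ⟨t, ht.trans hT, h⟩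

theorem RunsLe.seq {p q : StackProg} {s s' s'' : Store} {T T' : ℕ} (h : RunsLe p s s' T)
    (h' : RunsLe q s' s'' T') : RunsLe (.seq p q) s s'' (T + T') := by
  obtain ⟨t, ht, h⟩ := h
  obtain ⟨t', ht', h'⟩ := h'
  exact ⟨t + t', by omega, .seq h h'⟩

theorem RunsLe.shift {p : StackProg} {l l' : List (List Bool)} {T : ℕ}
    (h : RunsLe p (st l) (st l') T) (u : List (List Bool)) :
    RunsLe (p.shift u.length) (st (u ++ l)) (st (u ++ l')) T := by
  obtain ⟨t, ht, h⟩ := h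
  rw [st_append, st_append]
  exact ⟨t, ht, h.shift _ _⟩

theorem RunsLe.push {l : List (List Bool)} (r : ℕ) (b : Bool) (h : r < l.length) :
    RunsLe (.push r b) (st l) (st (l.set r (b :: l.getD r []))) 1 :=
  ⟨1, le_rfl, by rw [← update_st h]; exact .push r b _⟩

theorem RunsLe.pop {l : List (List Bool)} (r : ℕ) (h : r < l.length) :
    RunsLe (.pop r) (st l) (st (l.set r (l.getD r []).tail)) 1 :=
  ⟨1, le_rfl, by rw [← update_st h]; exact .pop r _⟩

theorem RunsLe.branchNil {r : ℕ} {p₀ p₁ p₂ : StackProg} {s s' : Store} {T : ℕ} (h : s r = [])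
    (h' : RunsLe p₀ s s' T) : RunsLe (.branch r p₀ p₁ p₂) s s' (T + 1) := by
  obtain ⟨t, ht, h'⟩ := h'
  exact ⟨t + 1, by omega, .branchNil h h'⟩

theorem RunsLe.branchCons {r : ℕ} {p₀ p₁ p₂ : StackProg} {s s' : Store} {T : ℕ} {b : Bool}
    {x : List Bool} (h : s r = b :: x) (h' : RunsLe (if b then p₂ else p₁) s s' T) :
    RunsLe (.branch r p₀ p₁ p₂) s s' (T + 1) := by
  obtain ⟨t, ht, h'⟩ := h'
  refine ⟨t + 1, by omega, ?_⟩
  cases b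
  · exact .branchFalse (by simp [h]) h'
  · exact .branchTrue (by simp [h]) h'

theorem RunsLe.loopDone {r : ℕ} {p : StackProg} {s : Store} (h : s r = []) :
    RunsLe (.loop r p) s s 1 := ⟨1, le_rfl, .loopDone h⟩

theorem RunsLe.loopStep {r : ℕ} {p : StackProg} {s s' s'' : Store} {T T' : ℕ} (h : s r ≠ [])
    (h₁ : RunsLe p s s' T) (h₂ : RunsLe (.loop r p) s' s'' T') :
    RunsLe (.loop r p) s s'' (T + T' + 1) := by
  obtain ⟨t, ht, h₁⟩ := h₁
  obtain ⟨t', ht', h₂⟩ := h₂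
  exact ⟨t + t' + 1, by omega, .loopStep h h₁ h₂⟩

/-! ### Elementary programs -/

/-- Move stack `a` to stack `b`, in reverse order. -/
def mv (a b : ℕ) : StackProg :=
  .loop a (.branch a .skip (.seq (.pop a) (.push b false)) (.seq (.pop a) (.push b true)))

theorem mv_runs (a b : ℕ) (hab : a ≠ b) : ∀ (x : List Bool) (s : Store), s a = x →
    RunsLe (mv a b) s
      (Function.update (Function.update s a []) b (x.reverse ++ s b)) (5 * x.length + 1)
  | [], s, h => by
    have : Function.update (Function.update s a []) b ([].reverse ++ s b) = s := by
      have e := Function.update_eq_self a s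
      rw [h] at e
      simp [e]
    rw [this]
    exact .loopDone h
  | c :: x, s, h => by
    set s₁ := Function.update s a x
    set s₂ := Function.update s₁ b (c :: s b)
    have ih := mv_runs a b hab x s₂ (by
      simp [s₂, s₁, Function.update_of_ne hab])
    have e : Function.update (Function.update s₂ a []) b (x.reverse ++ s₂ b) =
        Function.update (Function.update s a []) b ((c :: x).reverse ++ s b) := by
      funext i
      by_cases hb : i = b
      · subst hb; simp [s₂]
      · by_cases ha : i = a
        · subst ha; simp [Function.update_of_ne hb]
        · simp [s₂, s₁, Function.update_of_ne hb, Function.update_of_ne ha]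
    rw [e] at ih
    have h1 : Runs (.pop a) s s₁ 1 := by
      have := Runs.pop a s
      rwa [h] at this
    have h2 : Runs (.push b c) s₁ s₂ 1 := by
      have := Runs.push b c s₁
      rwa [show s₁ b = s b from Function.update_of_ne hab.symm _ _] at this
    have h3 : RunsLe (.branch a .skip (.seq (.pop a) (.push b false))
        (.seq (.pop a) (.push b true))) s s₂ (2 + 1) := by
      refine .branchCons h ⟨2, le_rfl, ?_⟩
      cases c <;> exact .seq h1 h2
    refine (RunsLe.loopStep (by simp [h]) h3 ih).mono ?_
    simp; omega

theorem RunsLe.mv {l : List (List Bool)} (a b : ℕ) (hab : a ≠ b) (ha : a < l.length)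
    (hb : b < l.length) : RunsLe (mv a b) (st l)
      (st ((l.set a []).set b ((l.getD a []).reverse ++ l.getD b [])))
      (5 * (l.getD a []).length + 1) := by
  have := mv_runs a b hab _ (st l) rfl
  rwa [update_st ha, update_st (by simpa using hb)] at this

/-- Empty stack `a`. -/
def clear (a : ℕ) : StackProg := .loop a (.pop a)

theorem clear_runs (a : ℕ) : ∀ (x : List Bool) (s : Store), s a = x →
    RunsLe (clear a) s (Function.update s a []) (2 * x.length + 1)
  | [], s, h => by
    have : Function.update s a [] = s := by simp [← h]
    rw [this]
    exact .loopDone h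
  | c :: x, s, h => by
    have h1 : Runs (.pop a) s (Function.update s a x) 1 := by
      have := Runs.pop a s
      rwa [h] at this
    have ih := clear_runs a x (Function.update s a x) (by simp)
    rw [Function.update_idem] at ih
    refine (RunsLe.loopStep (by simp [h]) ⟨1, le_rfl, h1⟩ ih).mono ?_
    simp; omega

theorem RunsLe.clear {l : List (List Bool)} (a : ℕ) (ha : a < l.length) :
    RunsLe (clear a) (st l) (st (l.set a [])) (2 * (l.getD a []).length + 1) := by
  have := clear_runs a _ (st l) rfl
  rwa [update_st ha] at this

/-- Move stack `a` to both stacks `b` and `c`, in reverse order. -/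
def mv2 (a b c : ℕ) : StackProg :=
  .loop a (.branch a .skip (.seq (.pop a) (.seq (.push b false) (.push c false)))
    (.seq (.pop a) (.seq (.push b true) (.push c true))))

theorem RunsLe.dup (x u v : List Bool) :
    RunsLe (mv2 1 0 2) (st [u, x, v]) (st [x.reverse ++ u, [], x.reverse ++ v])
      (7 * x.length + 1) := by
  induction x generalizing u v with
  | nil => exact .loopDone rfl
  | cons c x ih =>
    have h : RunsLe (.branch 1 .skip (.seq (.pop 1) (.seq (.push 0 false) (.push 2 false)))
        (.seq (.pop 1) (.seq (.push 0 true) (.push 2 true)))) (st [u, c :: x, v])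
        (st [c :: u, x, c :: v]) (1 + (1 + 1) + 1) := by
      refine .branchCons (x := x) rfl ?_
      cases c <;> exact .seq (RunsLe.pop (l := [u, _ :: x, v]) 1 (by simp))
        (.seq (RunsLe.push (l := [u, x, v]) 0 _ (by simp))
          (RunsLe.push (l := [_ :: u, x, v]) 2 _ (by simp)))
    have := RunsLe.loopStep (by simp [st]) h (ih (c :: u) (c :: v))
    simp only [List.reverse_cons, List.append_assoc, List.singleton_append, List.length_cons]
    exact this.mono (by omega)

/-- Push the row encoding of the reverse of stack `1` on stack `2`. -/
def encRowProg : StackProg :=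
  .seq (.push 2 false) (.loop 1 (.branch 1 .skip
    (.seq (.pop 1) (.seq (.push 2 false) (.push 2 true)))
    (.seq (.pop 1) (.seq (.push 2 true) (.push 2 true)))))

theorem encodeRow_nil : encodeRow [] = [false] := rfl

theorem encodeRow_cons (b : Bool) (x : List Bool) :
    encodeRow (b :: x) = true :: b :: encodeRow x := by simp [encodeRow]

theorem length_encodeRow (x : List Bool) : (encodeRow x).length = 2 * x.length + 1 := by
  induction x with
  | nil => rfl
  | cons b x ih => rw [encodeRow_cons]; simp [ih]; omega

theorem encRowProg_runs (x v w : List Bool) :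
    RunsLe encRowProg (st [w, x.reverse, v]) (st [w, [], encodeRow x ++ v])
      (7 * x.length + 2) := by
  have key : ∀ (x v : List Bool), RunsLe (.loop 1 (.branch 1 .skip
      (.seq (.pop 1) (.seq (.push 2 false) (.push 2 true)))
      (.seq (.pop 1) (.seq (.push 2 true) (.push 2 true))))) (st [w, x, v])
      (st [w, [], x.reverse.flatMap (fun b => [true, b]) ++ v]) (7 * x.length + 1) := by
    intro x
    induction x with
    | nil => exact fun v => .loopDone rfl
    | cons c x ih =>
      intro v
      have h : RunsLe (.branch 1 .skip (.seq (.pop 1) (.seq (.push 2 false) (.push 2 true)))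
          (.seq (.pop 1) (.seq (.push 2 true) (.push 2 true)))) (st [w, c :: x, v])
          (st [w, x, true :: c :: v]) (1 + (1 + 1) + 1) := by
        refine .branchCons (x := x) rfl ?_
        cases c <;> exact .seq (RunsLe.pop (l := [w, _ :: x, v]) 1 (by simp))
          (.seq (RunsLe.push (l := [w, x, v]) 2 _ (by simp))
            (RunsLe.push (l := [w, x, _ :: v]) 2 _ (by simp)))
      have := RunsLe.loopStep (by simp [st]) h (ih (true :: c :: v))
      simp only [List.reverse_cons, List.flatMap_append, List.append_assoc, List.length_cons]
      exact this.mono (by omega)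
  have := RunsLe.seq (RunsLe.push (l := [w, x.reverse, v]) 2 false (by simp))
    (key x.reverse (false :: v))
  simp only [List.reverse_reverse, List.length_reverse] at this
  simp only [encodeRow, List.append_assoc, List.singleton_append]
  exact this.mono (by omega)

/-- Split the row encoding of `a` from stack `0`, and put the reverse of `a` on stack `2`. -/
def unpairProg : StackProg :=
  .seq (.push 1 true) (.loop 1 (.branch 0 .skip (.seq (.pop 0) (.pop 1))
    (.seq (.pop 0) (.branch 0 .skip (.seq (.pop 0) (.push 2 false))
      (.seq (.pop 0) (.push 2 true))))))

/-- Stack `1` carries a single `true` as loop flag; it is popped when the end mark of the row is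
read. -/
theorem unpairProg_runs (a b : List Bool) :
    RunsLe unpairProg (st [encodeRow a ++ b]) (st [b, [], a.reverse]) (7 * a.length + 6) := by
  have key : ∀ (a v : List Bool), RunsLe (.loop 1 (.branch 0 .skip (.seq (.pop 0) (.pop 1))
      (.seq (.pop 0) (.branch 0 .skip (.seq (.pop 0) (.push 2 false))
        (.seq (.pop 0) (.push 2 true)))))) (st [encodeRow a ++ b, [true], v])
        (st [b, [], a.reverse ++ v]) (7 * a.length + 5) := by
    intro a
    induction a with
    | nil =>
      intro v
      refine (RunsLe.loopStep (T := 1 + 1 + 1) (s' := st [b, [], v]) (by simp [st]) ?_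
        (.loopDone rfl)).mono (by simp)
      refine .branchCons (b := false) (x := b) rfl ?_
      exact .seq (RunsLe.pop (l := [false :: b, [true], v]) 0 (by simp))
        (RunsLe.pop (l := [b, [true], v]) 1 (by simp))
    | cons c a ih =>
      intro v
      have := ih (c :: v)
      simp only [List.reverse_cons, List.append_assoc, List.singleton_append, List.length_cons,
        encodeRow_cons]
      refine (RunsLe.loopStep (T := 1 + (1 + 1 + 1) + 1) (by simp [st]) ?_ this).mono (by omega)
      refine .branchCons (b := true) (x := c :: (encodeRow a ++ b)) rfl ?_
      refine .seq (RunsLe.pop (l := [true :: c :: (encodeRow a ++ b), [true], v]) 0 (by simp)) ?_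
      refine .branchCons (x := encodeRow a ++ b) rfl ?_
      cases c <;> exact .seq (RunsLe.pop (l := [_ :: (encodeRow a ++ b), [true], v]) 0 (by simp))
        (RunsLe.push (l := [encodeRow a ++ b, [true], v]) 2 _ (by simp))
  have e : st [encodeRow a ++ b] = st [encodeRow a ++ b, [], []] := by
    rw [← st_append_nil, ← st_append_nil]; rfl
  rw [e]
  have := RunsLe.seq (RunsLe.push (l := [encodeRow a ++ b, [], []]) 1 true (by simp)) (key a [])
  rw [List.append_nil] at this
  exact this.mono (by omega)

/-! ### Polynomial-time functions between encoded types -/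

/-- An encoding of the elements of a type by strings. -/
class Enc (α : Type) where
  enc : α → List Bool

open Enc (enc)

instance : Enc (List Bool) := ⟨id⟩

instance : Enc (List (List Bool)) := ⟨fun l => l.flatMap encodeRow⟩

instance {α β : Type} [Enc α] [Enc β] : Enc (α × β) := ⟨fun p => encodeRow (enc p.1) ++ enc p.2⟩

/-- The length of the encoding. -/
def size {α : Type} [Enc α] (a : α) : ℕ := (enc a).length

variable {α β γ σ : Type} [Enc α] [Enc β] [Enc γ] [Enc σ]

theorem enc_string (x : List Bool) : enc x = x := rfl

theorem enc_pair (a : α) (b : β) : enc (a, b) = encodeRow (enc a) ++ enc b := rfl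

theorem enc_nil : enc ([] : List (List Bool)) = [] := rfl

theorem enc_cons (w : List Bool) (l : List (List Bool)) : enc (w :: l) = encodeRow w ++ enc l := rfl

theorem enc_append (l l' : List (List Bool)) : enc (l ++ l') = enc l ++ enc l' := by
  simp [enc]

theorem size_string (x : List Bool) : size x = x.length := rfl

theorem size_pair (a : α) (b : β) : size (a, b) = 2 * size a + 1 + size b := by
  simp [size, enc_pair, length_encodeRow]

theorem size_nil : size ([] : List (List Bool)) = 0 := rfl

theorem size_cons (w : List Bool) (l : List (List Bool)) :
    size (w :: l) = 2 * w.length + 1 + size l := by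
  simp [size, enc_cons, length_encodeRow]

theorem size_append (l l' : List (List Bool)) : size (l ++ l') = size l + size l' := by
  simp [size, enc_append]

/-- `f` is computed by a program in polynomial time; all auxiliary stacks are empty at the end. -/
def PT (f : α → β) : Prop :=
  ∃ (p : StackProg) (b : Polynomial ℕ), ∀ a, RunsLe p (st [enc a]) (st [enc (f a)]) (b.eval (size a))

/-- `f` is bounded by a polynomial in the size. -/
def PolyB (f : α → ℕ) : Prop := ∃ b : Polynomial ℕ, ∀ a, f a ≤ b.eval (size a)

/-- Coefficients in `ℕ` make every polynomial monotone, so a bound on the argument may be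
substituted. -/
theorem eval_mono (b : Polynomial ℕ) {m n : ℕ} (h : m ≤ n) : b.eval m ≤ b.eval n := by
  simp only [Polynomial.eval_eq_sum, Polynomial.sum]
  gcongr

theorem PolyB.mono {f g : α → ℕ} (hg : PolyB g) (h : ∀ a, f a ≤ g a) : PolyB f := by
  obtain ⟨b, hb⟩ := hg
  exact ⟨b, fun a => (h a).trans (hb a)⟩

theorem PolyB.const (n : ℕ) : PolyB (fun _ : α => n) := ⟨Polynomial.C n, fun a => by simp⟩

theorem PolyB.size : PolyB (fun a : α => size a) := ⟨Polynomial.X, fun a => by simp⟩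

theorem PolyB.add {f g : α → ℕ} (hf : PolyB f) (hg : PolyB g) : PolyB (fun a => f a + g a) := by
  obtain ⟨b, hb⟩ := hf
  obtain ⟨c, hc⟩ := hg
  exact ⟨b + c, fun a => by simpa using add_le_add (hb a) (hc a)⟩

theorem PolyB.mul {f g : α → ℕ} (hf : PolyB f) (hg : PolyB g) : PolyB (fun a => f a * g a) := by
  obtain ⟨b, hb⟩ := hf
  obtain ⟨c, hc⟩ := hg
  exact ⟨b * c, fun a => by simpa using Nat.mul_le_mul (hb a) (hc a)⟩

theorem PolyB.pow {f : α → ℕ} (hf : PolyB f) (n : ℕ) : PolyB (fun a => f a ^ n) := by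
  obtain ⟨b, hb⟩ := hf
  exact ⟨b ^ n, fun a => by simpa using Nat.pow_le_pow_left (hb a) n⟩

theorem PolyB.eval {f : α → ℕ} (hf : PolyB f) (c : Polynomial ℕ) :
    PolyB (fun a => c.eval (f a)) := by
  obtain ⟨b, hb⟩ := hf
  exact ⟨c.comp b, fun a => by simpa using eval_mono c (hb a)⟩

theorem PT.polyB {f : α → β} (hf : PT f) : PolyB (fun a => JohnsonClustering.size (f a)) := by
  obtain ⟨p, b, h⟩ := hf
  refine ⟨Polynomial.X + b, fun a => ?_⟩
  obtain ⟨t, ht, h⟩ := h a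
  have := h.length_le 0
  simp only [Polynomial.eval_add, Polynomial.eval_X]
  exact this.trans (add_le_add le_rfl ht)

/-- A program whose running time is polynomially bounded. -/
theorem PT.of_polyB {f : α → β} (p : StackProg) {T : α → ℕ} (hT : PolyB T)
    (h : ∀ a, RunsLe p (st [enc a]) (st [enc (f a)]) (T a)) : PT f := by
  obtain ⟨b, hb⟩ := hT
  exact ⟨p, b, fun a => (h a).mono (hb a)⟩

/-- A machine sees encodings only, so functions may be exchanged for others with the same encodings.
The map `g` need not be effective. -/
theorem PT.of_enc {F : β → γ} (hF : PT F) {f : α → σ} (g : α → β) (hg : ∀ a, enc (g a) = enc a)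
    (h : ∀ a, enc (F (g a)) = enc (f a)) : PT f := by
  obtain ⟨p, b, hp⟩ := hF
  refine ⟨p, b, fun a => ?_⟩
  have := hp (g a)
  rwa [h, hg, show JohnsonClustering.size (g a) = JohnsonClustering.size a by
    simp [JohnsonClustering.size, hg]] at this

theorem PT.of_enc_eq {f : α → β} (h : ∀ a, enc (f a) = enc a) : PT f :=
  .of_polyB .skip (.const 1) fun a => ⟨1, le_rfl, by rw [h]; exact .skip _⟩

theorem PT.id : PT (fun a : α => a) := .of_enc_eq fun _ => rfl

theorem PT.comp {g : β → γ} (hg : PT g) {f : α → β} (hf : PT f) : PT (fun a => g (f a)) := by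
  have hf' := hf
  obtain ⟨p, b, hp⟩ := hf
  obtain ⟨q, c, hq⟩ := hg
  exact .of_polyB (.seq p q) ((PolyB.size.eval b).add (hf'.polyB.eval c))
    fun a => (hp a).seq (hq (f a))

theorem st1_eq (x : List Bool) : st [x] = st [x, [], [], []] := by
  rw [← st_append_nil, ← st_append_nil, ← st_append_nil]; rfl

theorem st3_eq (x y z : List Bool) : st [x, y, z] = st [x, y, z, []] := by
  rw [← st_append_nil]; rfl

theorem PT.const (c : β) : PT (fun _ : α => c) := by
  have h : ∀ w : List Bool, ∃ p, RunsLe p (st [[]]) (st [w]) (w.length + 1) := by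
    intro w
    induction w with
    | nil => exact ⟨.skip, 1, by simp, .skip _⟩
    | cons b w ih =>
      obtain ⟨p, hp⟩ := ih
      exact ⟨.seq p (.push 0 b), hp.seq (RunsLe.push (l := [w]) 0 b (by simp))⟩
  obtain ⟨p, hp⟩ := h (enc c)
  refine .of_polyB (.seq (clear 0) p) (T := fun a => 2 * JohnsonClustering.size a + 1 +
    ((enc c).length + 1)) (((PolyB.const 2).mul .size |>.add (.const 1)).add (.const _)) fun a => ?_
  exact (RunsLe.clear (l := [enc a]) 0 (by simp)).seq hp

/-- The input is duplicated, `g` runs on one copy on stack `2`, then `f` on the other copy on stack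
`3`, and the first result is encoded as a row in front of the second. Each `mv` reverses its string,
so moves come in pairs or are compensated by `mv2` and `encRowProg`. -/
theorem PT.pair {f : α → β} (hf : PT f) {g : α → γ} (hg : PT g) : PT (fun a => (f a, g a)) := by
  have hf' := hf.polyB
  have hg' := hg.polyB
  obtain ⟨p, b, hp⟩ := hf
  obtain ⟨q, c, hq⟩ := hg
  refine .of_polyB (.seq (mv 0 1) (.seq (mv2 1 0 2) (.seq (q.shift 2) (.seq (mv 0 1)
    (.seq (mv 1 3) (.seq (p.shift 3) (.seq (mv 3 1) (.seq encRowProg (.seq (mv 2 1)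
    (mv 1 0)))))))))) (T := fun a => (5 * size a + 1) + ((7 * size a + 1) +
      (c.eval (size a) + ((5 * size a + 1) + ((5 * size a + 1) + (b.eval (size a) +
      ((5 * size (f a) + 1) + ((7 * size (f a) + 2) + ((5 * size (f a, g a) + 1) +
      (5 * size (f a, g a) + 1))))))))))
    ?_ fun a => ?_
  · simp only [size_pair]
    have h5 : PolyB (fun _ : α => 5) := .const 5
    have h7 : PolyB (fun _ : α => 7) := .const 7
    have h1 : PolyB (fun _ : α => 1) := .const 1
    have h2 : PolyB (fun _ : α => 2) := .const 2
    have hs : PolyB (fun a : α => size a) := .size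
    have hb := hs.eval b
    have hc := hs.eval c
    have hp := (((h2.mul hf').add h1).add hg')
    exact ((h5.mul hs).add h1).add (((h7.mul hs).add h1).add (hc.add (((h5.mul hs).add h1).add
      (((h5.mul hs).add h1).add (hb.add (((h5.mul hf').add h1).add (((h7.mul hf').add h2).add
      (((h5.mul hp).add h1).add ((h5.mul hp).add h1)))))))))
  · set x := enc a
    have e1 := RunsLe.mv (l := [x, [], [], []]) 0 1 (by simp) (by simp) (by simp)
    have e2 := RunsLe.dup x.reverse [] []
    have e3 := (hq a).shift [x, []]
    have e4 := RunsLe.mv (l := [x, [], enc (g a), []]) 0 1 (by simp) (by simp) (by simp)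
    have e5 := RunsLe.mv (l := [[], x.reverse, enc (g a), []]) 1 3 (by simp) (by simp) (by simp)
    have e6 := (hp a).shift [[], [], enc (g a)]
    have e7 := RunsLe.mv (l := [[], [], enc (g a), enc (f a)]) 3 1 (by simp) (by simp) (by simp)
    have e8 := encRowProg_runs (enc (f a)) (enc (g a)) []
    have e9 := RunsLe.mv (l := [[], [], enc (f a, g a), []]) 2 1 (by simp) (by simp) (by simp)
    have e10 := RunsLe.mv (l := [[], (enc (f a, g a)).reverse, [], []]) 1 0 (by simp) (by simp)
      (by simp)
    simp only [List.append_nil, List.reverse_reverse, List.length_reverse, List.set_cons_zero,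
      List.set_cons_succ, List.getD_cons_zero, List.getD_cons_succ, List.cons_append,
      List.nil_append, st3_eq, st1_eq, List.length_cons, List.length_nil, zero_add,
      Nat.reduceAdd] at e1 e2 e3 e4 e5 e6 e7 e8 e9 e10 ⊢
    exact e1.seq (e2.seq (e3.seq (e4.seq (e5.seq (e6.seq (e7.seq (e8.seq (e9.seq e10))))))))

theorem PT.fst : PT (fun p : α × β => p.1) := by
  refine .of_polyB (.seq unpairProg (.seq (clear 0) (mv 2 0)))
    (T := fun p => (7 * size p + 6) + ((2 * size p + 1) + (5 * size p + 1))) ?_ fun p => ?_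
  · exact (((PolyB.const 7).mul .size).add (.const 6)).add
      ((((PolyB.const 2).mul .size).add (.const 1)).add
        (((PolyB.const 5).mul .size).add (.const 1)))
  · obtain ⟨a, b⟩ := p
    have e1 := unpairProg_runs (enc a) (enc b)
    have e2 := RunsLe.clear (l := [enc b, [], (enc a).reverse]) 0 (by simp)
    have e3 := RunsLe.mv (l := [[], [], (enc a).reverse]) 2 0 (by simp) (by simp) (by simp)
    simp only [List.append_nil, List.reverse_reverse, List.length_reverse, List.set_cons_zero,
      List.set_cons_succ, List.getD_cons_zero, List.getD_cons_succ,
      st3_eq, st1_eq] at e1 e2 e3 ⊢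
    refine (e1.seq (e2.seq e3)).mono ?_
    rw [size_pair]
    simp only [size]
    omega

theorem PT.snd : PT (fun p : α × β => p.2) := by
  refine .of_polyB (.seq unpairProg (clear 2))
    (T := fun p => (7 * size p + 6) + (2 * size p + 1)) ?_ fun p => ?_
  · exact (((PolyB.const 7).mul .size).add (.const 6)).add
      (((PolyB.const 2).mul .size).add (.const 1))
  · obtain ⟨a, b⟩ := p
    have e1 := unpairProg_runs (enc a) (enc b)
    have e2 := RunsLe.clear (l := [enc b, [], (enc a).reverse]) 2 (by simp)
    simp only [List.length_reverse, List.set_cons_zero,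
      List.set_cons_succ, List.getD_cons_zero, List.getD_cons_succ,
      st3_eq, st1_eq] at e1 e2 ⊢
    refine (e1.seq e2).mono ?_
    rw [size_pair]
    simp only [size]
    omega

theorem PT.append : PT (fun p : List Bool × List Bool => p.1 ++ p.2) := by
  refine .of_polyB (.seq unpairProg (mv 2 0))
    (T := fun p => (7 * size p + 6) + (5 * size p + 1)) ?_ fun p => ?_
  · exact (((PolyB.const 7).mul .size).add (.const 6)).add
      (((PolyB.const 5).mul .size).add (.const 1))
  · obtain ⟨a, b⟩ := p
    have e1 := unpairProg_runs a b
    have e2 := RunsLe.mv (l := [b, [], a.reverse]) 2 0 (by simp) (by simp) (by simp)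
    simp only [List.length_reverse, List.set_cons_zero, List.reverse_reverse,
      List.set_cons_succ, List.getD_cons_zero, List.getD_cons_succ,
      st3_eq, st1_eq] at e1 e2 ⊢
    refine (e1.seq e2).mono ?_
    rw [size_pair]
    simp only [size_string]
    omega

theorem PT.cons (b : Bool) : PT (fun x : List Bool => b :: x) :=
  .of_polyB (.push 0 b) (.const 1) fun x => RunsLe.push (l := [x]) 0 b (by simp)

theorem PT.tail : PT (fun x : List Bool => x.tail) :=
  .of_polyB (.pop 0) (.const 1) fun x => RunsLe.pop (l := [x]) 0 (by simp)

/-- The encoding of `(c a, a)` starts with `false` exactly when `c a` is empty, so one branch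
decides; in that case popping the symbol leaves the encoding of `a`. -/
theorem PT.ifNil {c : α → List Bool} (hc : PT c) {f g : α → β} (hf : PT f) (hg : PT g) :
    PT (fun a => if c a = [] then f a else g a) := by
  have h1 : PT (fun p : List Bool × α => if p.1 = [] then f p.2 else g p.2) := by
    obtain ⟨p, b, hp⟩ := hf
    obtain ⟨q, d, hq⟩ := hg.comp (PT.snd (α := List Bool) (β := α))
    refine .of_polyB (.branch 0 .skip (.seq (.pop 0) p) q)
      (T := fun p => 1 + b.eval (size p) + d.eval (size p) + 1)
      ((((PolyB.const 1).add (PolyB.size.eval b)).add (PolyB.size.eval d)).add (.const 1))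
      fun a => ?_
    obtain ⟨x, a⟩ := a
    rcases x with _ | ⟨c, x⟩
    · refine (RunsLe.branchCons (b := false) (x := enc a) rfl
        (.seq (RunsLe.pop (l := [false :: enc a]) 0 (by simp)) (hp a))).mono ?_
      have : b.eval (size a) ≤ b.eval (size (([] : List Bool), a)) :=
        eval_mono b (by rw [size_pair]; omega)
      omega
    · refine (RunsLe.branchCons (b := true) (x := c :: (encodeRow x ++ enc a)) ?_
        (hq (c :: x, a))).mono ?_
      · simp [st, enc_pair, enc_string, encodeRow_cons]
      · omega
  exact h1.comp (hc.pair .id)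

theorem PT.headTrue : PT (fun x : List Bool => if x.head? = some true then [true] else []) := by
  refine .of_polyB (.branch 0 .skip (clear 0) (.seq (clear 0) (.push 0 true)))
    (T := fun x => 2 * size x + 1 + 1 + 1)
    ((((PolyB.const 2).mul .size).add (.const 1)).add (.const 1) |>.add (.const 1)) fun x => ?_
  rcases x with _ | ⟨_ | _, x⟩
  · exact (RunsLe.branchNil rfl ⟨1, le_rfl, .skip _⟩).mono (by omega)
  · exact (RunsLe.branchCons (b := false) (x := x) rfl
      (RunsLe.clear (l := [false :: x]) 0 (by simp))).mono (by simp [size_string])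
  · exact RunsLe.branchCons (b := true) (x := x) rfl
      ((RunsLe.clear (l := [true :: x]) 0 (by simp)).seq
        (RunsLe.push (l := [[]]) 0 true (by simp)))

theorem PT.flat : PT (fun l : List (List Bool) => l.flatMap encodeRow) := .of_enc_eq fun _ => rfl

theorem PT.listCons : PT (fun p : List Bool × List (List Bool) => p.1 :: p.2) :=
  .of_enc_eq fun _ => rfl

theorem PT.listAppend : PT (fun p : List (List Bool) × List (List Bool) => p.1 ++ p.2) :=
  (PT.append).of_enc (fun p => (enc p.1, enc p.2)) (fun _ => rfl) fun p => (enc_append p.1 p.2).symm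

/-- A nonempty list and the pair of its head and tail have the same encoding; only the empty list
needs an extra `false`. -/
theorem PT.uncons : PT (fun l : List (List Bool) => (l.headD [], l.tail)) := by
  refine .of_polyB (.branch 0 (.push 0 false) .skip .skip) (.const 2) fun l => ?_
  rcases l with _ | ⟨w, l⟩
  · exact .branchNil rfl (RunsLe.push (l := [[]]) 0 false (by simp))
  · rcases w with _ | ⟨c, w⟩
    · exact .branchCons (b := false) (x := enc l) rfl ⟨1, le_rfl, .skip _⟩
    · exact .branchCons (b := true) (x := c :: (encodeRow w ++ enc l))
        (by simp [st, enc_cons, encodeRow_cons]) ⟨1, le_rfl, .skip _⟩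

/-- Folding over the bits of a string, when all intermediate states have polynomial size. -/
theorem PT.foldBits {F G : σ → σ} (hF : PT F) (hG : PT G) {x : α → List Bool} (hx : PT x)
    {s : α → σ} (hs : PT s) {B : α → ℕ} (hB : PolyB B)
    (h : ∀ a l, l <+: x a → size (l.foldl (fun s b => if b then G s else F s) (s a)) ≤ B a) :
    PT (fun a => (x a).foldl (fun s b => if b then G s else F s) (s a)) := by
  have hx' := hx.polyB
  have hs' := hs.polyB
  obtain ⟨r, d, hr⟩ := hx.pair hs
  obtain ⟨p, b, hp⟩ := hF
  obtain ⟨q, c, hq⟩ := hG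
  set body : StackProg :=
    .branch 0 .skip (.seq (.pop 0) (p.shift 2)) (.seq (.pop 0) (q.shift 2))
  -- The string is consumed on stack `0` while the state is kept on stack `2`. As all intermediate
  -- states have size at most `N`, every round has the same time bound.
  have key : ∀ (N : ℕ) (x : List Bool) (s : σ),
      (∀ l, l <+: x → size (l.foldl (fun s b => if b then G s else F s) s) ≤ N) →
      RunsLe (.loop 0 body) (st [x, [], enc s])
        (st [[], [], enc (x.foldl (fun s b => if b then G s else F s) s)])
        (x.length * (b.eval N + c.eval N + 3) + 1) := by
    intro N x
    induction x with
    | nil => exact fun s _ => (RunsLe.loopDone rfl).mono (by simp)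
    | cons e x ih =>
      intro s hN
      have ih' := ih (if e then G s else F s) fun l hl => by
        have := hN (e :: l) (by simpa using hl)
        simpa using this
      have h0 : size s ≤ N := hN [] (by simp)
      have hb := eval_mono b h0
      have hc := eval_mono c h0
      have hstep : RunsLe body (st [e :: x, [], enc s])
          (st [x, [], enc (if e then G s else F s)]) (b.eval N + c.eval N + 2) := by
        refine (RunsLe.branchCons (T := b.eval N + c.eval N + 1) (x := x) rfl ?_)
        have e1 := RunsLe.pop (l := [e :: x, [], enc s]) 0 (by simp)
        cases e
        · exact (e1.seq ((hp s).shift [x, []])).mono (by omega)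
        · exact (e1.seq ((hq s).shift [x, []])).mono (by omega)
      refine (RunsLe.loopStep (by simp [st]) hstep ih').mono ?_
      simp only [List.length_cons]
      ring_nf
      omega
  refine .of_polyB (.seq r (.seq unpairProg (.seq (mv 0 1) (.seq (mv 2 0) (.seq (mv 1 2)
    (.seq (.loop 0 body) (.seq (mv 2 1) (mv 1 0))))))))
    (T := fun a => d.eval (size a) + ((7 * size (x a) + 6) + ((5 * size (s a) + 1) +
      ((5 * size (x a) + 1) + ((5 * size (s a) + 1) +
      ((size (x a) * (b.eval (B a) + c.eval (B a) + 3) + 1) +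
      ((5 * B a + 1) + (5 * B a + 1)))))))) ?_ fun a => ?_
  · have h5 : PolyB (fun _ : α => 5) := .const 5
    have h7 : PolyB (fun _ : α => 7) := .const 7
    have h1 : PolyB (fun _ : α => 1) := .const 1
    have h3 : PolyB (fun _ : α => 3) := .const 3
    have h6 : PolyB (fun _ : α => 6) := .const 6
    have hb := hB.eval b
    have hc := hB.eval c
    exact (PolyB.size.eval d).add (((h7.mul hx').add h6).add (((h5.mul hs').add h1).add
      (((h5.mul hx').add h1).add (((h5.mul hs').add h1).add
      (((hx'.mul ((hb.add hc).add h3)).add h1).add (((h5.mul hB).add h1).add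
        ((h5.mul hB).add h1)))))))
  · set R := (x a).foldl (fun s b => if b then G s else F s) (s a)
    have hR : size R ≤ B a := h a (x a) (List.prefix_refl _)
    have e0 := hr a
    have e1 := unpairProg_runs (x a) (enc (s a))
    have e2 := RunsLe.mv (l := [enc (s a), [], (x a).reverse]) 0 1 (by simp) (by simp) (by simp)
    have e3 := RunsLe.mv (l := [[], (enc (s a)).reverse, (x a).reverse]) 2 0 (by simp) (by simp)
      (by simp)
    have e4 := RunsLe.mv (l := [x a, (enc (s a)).reverse, []]) 1 2 (by simp) (by simp) (by simp)
    have e5 := key (B a) (x a) (s a) (h a)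
    have e6 := RunsLe.mv (l := [[], [], enc R]) 2 1 (by simp) (by simp) (by simp)
    have e7 := RunsLe.mv (l := [[], (enc R).reverse, []]) 1 0 (by simp) (by simp) (by simp)
    simp only [List.append_nil, List.reverse_reverse, List.length_reverse, List.set_cons_zero,
      List.set_cons_succ, List.getD_cons_zero, List.getD_cons_succ, enc_pair, enc_string,
      st3_eq, st1_eq] at e0 e1 e2 e3 e4 e5 e6 e7 ⊢
    refine (e0.seq (e1.seq (e2.seq (e3.seq (e4.seq (e5.seq (e6.seq e7))))))).mono ?_
    simp only [size, enc_string] at hR ⊢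
    omega

end JohnsonClustering

/-! ### Loops with a parameter, iteration, and lists of strings -/

namespace JohnsonClustering
open Enc (enc)
variable {α β γ σ : Type} [Enc α] [Enc β] [Enc γ] [Enc σ]

/-- Folding over the bits of a string with a parameter `a`. -/
theorem PT.foldBitsCtx {F G : α × σ → σ} (hF : PT F) (hG : PT G) {x : α → List Bool} (hx : PT x)
    {s : α → σ} (hs : PT s) {B : α → ℕ} (hB : PolyB B)
    (h : ∀ a l, l <+: x a →
      size (l.foldl (fun s b => if b then G (a, s) else F (a, s)) (s a)) ≤ B a) :
    PT (fun a => (x a).foldl (fun s b => if b then G (a, s) else F (a, s)) (s a)) := by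
  have key : ∀ (a : α) (l : List Bool) (s : σ),
      l.foldl (fun p b => if b then (p.1, G p) else (p.1, F p)) (a, s) =
        (a, l.foldl (fun s b => if b then G (a, s) else F (a, s)) s) := by
    intro a l
    induction l with
    | nil => exact fun s => rfl
    | cons b l ih => intro s; cases b <;> simp [ih]
  have := PT.foldBits (PT.fst.pair hF) (PT.fst.pair hG) hx (PT.id.pair hs)
    (B := fun a => 2 * size a + 1 + B a)
    ((((PolyB.const 2).mul .size).add (.const 1)).add hB) fun a l hl => by
      rw [key, size_pair]
      have := h a l hl
      omega
  simp only [key] at this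
  exact PT.snd.comp this

/-- Folding over the bits of a string, when each step increases the size by at most `c a`. -/
theorem PT.foldBitsIncr {F G : α × σ → σ} (hF : PT F) (hG : PT G) {x : α → List Bool} (hx : PT x)
    {s : α → σ} (hs : PT s) {c : α → ℕ} (hc : PolyB c)
    (h : ∀ a s, size (F (a, s)) ≤ size s + c a) (h' : ∀ a s, size (G (a, s)) ≤ size s + c a) :
    PT (fun a => (x a).foldl (fun s b => if b then G (a, s) else F (a, s)) (s a)) := by
  refine PT.foldBitsCtx hF hG hx hs (B := fun a => size (s a) + size (x a) * c a)
    (hs.polyB.add (hx.polyB.mul hc)) fun a l hl => ?_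
  have key : ∀ (l : List Bool) (s : σ),
      size (l.foldl (fun s b => if b then G (a, s) else F (a, s)) s) ≤ size s + l.length * c a := by
    intro l
    induction l with
    | nil => intro s; simp
    | cons b l ih =>
      intro s
      rw [List.foldl_cons, List.length_cons]
      refine (ih _).trans ?_
      have : size (if b then G (a, s) else F (a, s)) ≤ size s + c a := by
        cases b
        · exact h a s
        · exact h' a s
      rw [add_mul]
      omega
  refine (key l _).trans ?_
  have := Nat.mul_le_mul_right (c a) hl.length_le
  simp only [size_string]
  omega

theorem foldl_const_eq_iterate {τ : Type} (F : τ → τ) (l : List Bool) (s : τ) :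
    l.foldl (fun s b => if b then F s else F s) s = F^[l.length] s := by
  induction l generalizing s with
  | nil => rfl
  | cons b l ih => cases b <;> simpa using ih _

/-- Numbers of iterations are given in unary, as lengths of strings. -/
theorem PT.iterateCtx {F : α × σ → σ} (hF : PT F) {x : α → List Bool} (hx : PT x)
    {s : α → σ} (hs : PT s) {B : α → ℕ} (hB : PolyB B)
    (h : ∀ a n, n ≤ (x a).length → size ((fun s => F (a, s))^[n] (s a)) ≤ B a) :
    PT (fun a => (fun s => F (a, s))^[(x a).length] (s a)) := by
  have := PT.foldBitsCtx hF hF hx hs hB fun a l hl => by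
    rw [foldl_const_eq_iterate (fun s => F (a, s))]
    exact h a _ hl.length_le
  simpa only [foldl_const_eq_iterate (fun s => F (_, s))] using this

theorem PT.iterateIncr {F : α × σ → σ} (hF : PT F) {x : α → List Bool} (hx : PT x)
    {s : α → σ} (hs : PT s) {c : α → ℕ} (hc : PolyB c)
    (h : ∀ a s, size (F (a, s)) ≤ size s + c a) :
    PT (fun a => (fun s => F (a, s))^[(x a).length] (s a)) := by
  have := PT.foldBitsIncr hF hF hx hs hc h h
  simpa only [foldl_const_eq_iterate (fun s => F (_, s))] using this

theorem enc_eq_nil {l : List (List Bool)} : enc l = [] ↔ l = [] := by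
  cases l with
  | nil => simp [enc_nil]
  | cons w l => simp [enc_cons, encodeRow]

theorem length_le_size (l : List (List Bool)) : l.length ≤ size l := by
  induction l with
  | nil => simp
  | cons w l ih => rw [size_cons, List.length_cons]; omega

theorem length_le_size_of_mem {l : List (List Bool)} {w : List Bool} (h : w ∈ l) :
    w.length ≤ size l := by
  induction l with
  | nil => simp at h
  | cons v l ih =>
    rw [size_cons]
    rcases List.mem_cons.1 h with rfl | h
    · omega
    · have := ih h; omega

theorem size_le_of_sublist {l l' : List (List Bool)} (h : l.Sublist l') : size l ≤ size l' := by
  induction h with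
  | slnil => exact le_rfl
  | cons a _ ih => rw [size_cons]; omega
  | cons_cons a _ ih => rw [size_cons, size_cons]; omega

/-- Folding over a list of strings, when all intermediate states have polynomial size. -/
theorem PT.foldl {F : α × (σ × List Bool) → σ} (hF : PT F) {l : α → List (List Bool)} (hl : PT l)
    {s : α → σ} (hs : PT s) {B : α → ℕ} (hB : PolyB B)
    (h : ∀ a l', l' <+: l a → size (l'.foldl (fun s w => F (a, s, w)) (s a)) ≤ B a) :
    PT (fun a => (l a).foldl (fun s w => F (a, s, w)) (s a)) := by
  -- The loop runs once per bit of the encoded list, hence at least once per entry; `G` idles as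
  -- soon as the list is exhausted.
  set G : α × (List (List Bool) × σ) → List (List Bool) × σ := fun p =>
    if enc p.2.1 = [] then p.2 else (p.2.1.tail, F (p.1, p.2.2, p.2.1.headD []))
  have hG : PT G := by
    have h2 : PT (fun p : α × (List (List Bool) × σ) => p.2) := .snd
    have h21 := PT.fst.comp h2
    have hu := PT.uncons.comp h21
    exact PT.ifNil (PT.flat.comp h21) h2 ((PT.snd.comp hu).pair
      (hF.comp (PT.fst.pair ((PT.snd.comp h2).pair (PT.fst.comp hu)))))
  have key : ∀ (a : α) (n : ℕ) (l : List (List Bool)) (s : σ), (fun s => G (a, s))^[n] (l, s) =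
      (l.drop n, (l.take n).foldl (fun s w => F (a, s, w)) s) := by
    intro a n
    induction n with
    | zero => intro l s; simp
    | succ n ih =>
      intro l s
      rw [Function.iterate_succ_apply]
      cases l with
      | nil =>
        have : G (a, [], s) = ([], s) := by simp [G, enc_nil]
        rw [this, ih]; simp
      | cons w l =>
        have : G (a, w :: l, s) = (l, F (a, s, w)) := by simp [G, enc_eq_nil]
        rw [this, ih]; simp
  have := PT.iterateCtx hG (PT.flat.comp hl) (hl.pair hs)
    (B := fun a => 2 * size (l a) + 1 + B a)
    ((((PolyB.const 2).mul hl.polyB).add (.const 1)).add hB) fun a n _ => by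
      rw [key, size_pair]
      have := h a _ (List.take_prefix n (l a))
      have := size_le_of_sublist (List.drop_sublist n (l a))
      omega
  have h2 := PT.snd.comp this
  simp only [key] at h2
  convert h2 using 3 with a
  rw [List.take_of_length_le]
  exact length_le_size (l a)

theorem PT.flatMap {h : α × List Bool → List (List Bool)} (hh : PT h) {l : α → List (List Bool)}
    (hl : PT l) : PT (fun a => (l a).flatMap fun w => h (a, w)) := by
  obtain ⟨b, hb⟩ := hh.polyB
  have key : ∀ (a : α) (l : List (List Bool)) (s : List (List Bool)),
      l.foldl (fun s w => s ++ h (a, w)) s = s ++ l.flatMap fun w => h (a, w) := by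
    intro a l
    induction l with
    | nil => intro s; simp
    | cons w l ih => intro s; simp [ih]
  have h12 : PT (fun p : α × (List (List Bool) × List Bool) => p.2) := .snd
  have := PT.foldl (F := fun p : α × (List (List Bool) × List Bool) => p.2.1 ++ h (p.1, p.2.2))
    (PT.listAppend.comp ((PT.fst.comp h12).pair (hh.comp (PT.fst.pair (PT.snd.comp h12)))))
    hl (.const ([] : List (List Bool)))
    (B := fun a => size (l a) * b.eval (2 * size a + 1 + size (l a)))
    (hl.polyB.mul (((((PolyB.const 2).mul .size).add (.const 1)).add hl.polyB).eval b))
    fun a l' hl' => by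
      simp only [key, List.nil_append]
      have : ∀ l' : List (List Bool), (∀ w ∈ l', w ∈ l a) →
          size (l'.flatMap fun w => h (a, w)) ≤
            l'.length * b.eval (2 * size a + 1 + size (l a)) := by
        intro l'
        induction l' with
        | nil => intro _; simp [size_nil]
        | cons w l' ih =>
          intro hw
          have h1 := ih fun w' hw' => hw w' (by simp [hw'])
          have h2 : size (h (a, w)) ≤ _ := hb (a, w)
          have h3 := eval_mono b (show size (a, w) ≤ 2 * size a + 1 + size (l a) by
            rw [size_pair, size_string]
            have := length_le_size_of_mem (hw w (by simp))
            omega)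
          rw [List.flatMap_cons, size_append, List.length_cons, add_mul]
          omega
      refine (this l' fun w hw => hl'.subset hw).trans (Nat.mul_le_mul_right _ ?_)
      exact hl'.length_le.trans (length_le_size _)
  simpa only [key, List.nil_append] using this

theorem PT.map {h : α × List Bool → List Bool} (hh : PT h) {l : α → List (List Bool)}
    (hl : PT l) : PT (fun a => (l a).map fun w => h (a, w)) := by
  simp only [List.map_eq_flatMap]
  exact PT.flatMap (h := fun p => [h p]) (PT.listCons.comp (hh.pair (.const _))) hl

theorem PT.filter {c : α × List Bool → List Bool} (hc : PT c) {l : α → List (List Bool)}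
    (hl : PT l) : PT (fun a => (l a).filter fun w => c (a, w) ≠ []) := by
  have : ∀ a, ((l a).filter fun w => c (a, w) ≠ []) =
      (l a).flatMap fun w => if c (a, w) = [] then [] else [w] := by
    intro a
    induction l a with
    | nil => rfl
    | cons w l ih =>
      rw [List.flatMap_cons, ← ih]
      by_cases h : c (a, w) = [] <;> simp [h]
  simp only [this]
  exact PT.flatMap (h := fun p => if c p = [] then [] else [p.2])
    (.ifNil hc (.const _) (PT.listCons.comp (PT.snd.pair (.const _)))) hl

/-! ### Operations on strings -/

theorem PT.drop : PT (fun p : List Bool × List Bool => p.2.drop p.1.length) := by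
  have := PT.iterateIncr (F := fun p : (List Bool × List Bool) × List Bool => p.2.tail)
    (PT.tail.comp .snd) PT.fst PT.snd (PolyB.const 0) fun a s => by simp [size_string]
  convert this using 2 with p
  induction p.1.length with
  | zero => rfl
  | succ n ih => rw [Function.iterate_succ_apply', ← ih, List.tail_drop]

/-- As many `true`s as there are in `x`. -/
def trues (x : List Bool) : List Bool := List.replicate (x.count true) true

theorem PT.trues : PT trues := by
  have := PT.foldBitsIncr (F := fun p : List Bool × List Bool => p.2)
    (G := fun p => true :: p.2) .snd ((PT.cons true).comp .snd) (PT.id (α := List Bool))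
    (PT.const ([] : List Bool)) (PolyB.const 1) (fun a s => by simp)
    fun a s => by simp [size_string]
  convert this using 2 with x
  have key : ∀ (x s : List Bool), x.foldl (fun s b => if b then true :: s else s) s =
      List.replicate (x.count true) true ++ s := by
    intro x
    induction x with
    | nil => intro s; simp
    | cons b x ih =>
      intro s
      cases b
      · simp [ih]
      · simp [ih, List.replicate_succ']
  simp [key, JohnsonClustering.trues]

/-- A string of `false`s of the same length. -/
theorem PT.zeros : PT (fun x : List Bool => List.replicate x.length false) := by
  have := PT.iterateIncr (F := fun p : List Bool × List Bool => false :: p.2)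
    ((PT.cons false).comp .snd) (PT.id (α := List Bool))
    (PT.const ([] : List Bool)) (PolyB.const 1) (fun a s => by simp [size_string])
  convert this using 2 with x
  induction x.length with
  | zero => rfl
  | succ n ih => rw [Function.iterate_succ_apply', ← ih, List.replicate_succ]

theorem PT.zipWith (op : Bool → Bool → Bool) :
    PT (fun p : List Bool × List Bool => List.zipWith op p.1 p.2) := by
  set F : Bool → (List Bool × List Bool) × (List Bool × List Bool) → List Bool × List Bool :=
    fun b p => if p.2.1 = [] then p.2 else (p.2.1.tail,
      p.2.2 ++ (if (if p.2.1.head? = some true then [true] else []) = ([] : List Bool)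
        then [op b false] else [op b true])) with hFdef
  have hF : ∀ b, PT (F b) := fun b => by
    have h2 : PT (fun p : (List Bool × List Bool) × (List Bool × List Bool) => p.2) := .snd
    have h21 := PT.fst.comp h2
    exact .ifNil h21 h2 ((PT.tail.comp h21).pair (PT.append.comp ((PT.snd.comp h2).pair
      (.ifNil (PT.headTrue.comp h21) (.const [op b false]) (.const [op b true])))))
  have hsize : ∀ b p s, size (F b (p, s)) ≤ size s + 1 := fun b p s => by
    obtain ⟨u, v⟩ := s
    simp only [F]
    split_ifs <;> simp only [size_pair, size_string, List.length_append, List.length_tail,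
      List.length_singleton] <;> omega
  have := PT.foldBitsIncr (hF false) (hF true) PT.fst (PT.snd.pair (.const ([] : List Bool)))
    (PolyB.const 1) (hsize false) (hsize true)
  convert PT.snd.comp this using 2 with p
  have key : ∀ x y s : List Bool, x.foldl (fun s b => if b then F true (p, s) else F false (p, s))
      (y, s) = (y.drop x.length, s ++ List.zipWith op x y) := by
    intro x
    induction x with
    | nil => intro y s; simp
    | cons b x ih =>
      intro y s
      have e : (if b then F true (p, y, s) else F false (p, y, s)) = F b (p, y, s) := by
        cases b <;> rfl
      rw [List.foldl_cons, e]
      cases y with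
      | nil =>
        have : F b (p, [], s) = ([], s) := by simp [F]
        rw [this, ih]; simp
      | cons c y =>
        have : F b (p, c :: y, s) = (y, s ++ [op b c]) := by cases c <;> simp [F]
        rw [this, ih]; simp
  simp [key]

/-- Repeat a string `n` times. -/
def rep (n : ℕ) (x : List Bool) : List Bool := (List.replicate n x).flatten

theorem length_rep (n : ℕ) (x : List Bool) : (rep n x).length = n * x.length := by simp [rep]

theorem PT.rep (n : ℕ) : PT (rep n) := by
  induction n with
  | zero => exact .const []
  | succ n ih =>
    have : JohnsonClustering.rep (n + 1) = fun x => x ++ JohnsonClustering.rep n x := by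
      funext x; simp [JohnsonClustering.rep, List.replicate_succ]
    rw [this]
    exact PT.append.comp (PT.id.pair ih)

end JohnsonClustering

namespace JohnsonClustering
open Enc (enc)
variable {α β γ σ : Type} [Enc α] [Enc β] [Enc γ] [Enc σ]

/-! ### The reduction -/

/-- The words of `n` blocks from `Q`. -/
def words (Q : List (List Bool)) : ℕ → List (List Bool)
  | 0 => [[]]
  | n + 1 => Q.flatMap fun a => (words Q n).map fun w => a ++ w

theorem length_words (Q : List (List Bool)) (n : ℕ) : (words Q n).length = Q.length ^ n := by
  induction n with
  | zero => rfl
  | succ n ih => simp [words, ih, pow_succ']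

theorem length_of_mem_words {Q : List (List Bool)} {N : ℕ} (hQ : ∀ a ∈ Q, a.length ≤ N) :
    ∀ {n : ℕ} {w : List Bool}, w ∈ words Q n → w.length ≤ n * N
  | 0, w, hw => by simp [words] at hw; simp [hw]
  | n + 1, w, hw => by
    simp only [words, List.mem_flatMap, List.mem_map] at hw
    obtain ⟨a, ha, w', hw', rfl⟩ := hw
    have := length_of_mem_words hQ hw'
    have := hQ a ha
    rw [List.length_append, add_mul]
    omega

theorem size_le_of_forall_length_le {l : List (List Bool)} {N : ℕ} (h : ∀ w ∈ l, w.length ≤ N) :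
    size l ≤ l.length * (2 * N + 1) := by
  induction l with
  | nil => simp [size_nil]
  | cons w l ih =>
    rw [size_cons, List.length_cons, add_mul]
    have := ih fun w' hw' => h w' (by simp [hw'])
    have := h w (by simp)
    omega

/-- The number of words is exponential in their length. The assumed polynomial bound will hold
because the lengths are logarithmic. -/
theorem PT.words (Q : List (List Bool)) (hQ : Q ≠ []) {x : α → List Bool} (hx : PT x)
    (h : PolyB fun a => Q.length ^ (x a).length) :
    PT (fun a => JohnsonClustering.words Q (x a).length) := by
  have hstep : PT (fun p : α × List (List Bool) =>
      Q.flatMap fun a => p.2.map fun w => a ++ w) :=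
    PT.flatMap (h := fun q : (α × List (List Bool)) × List Bool => q.1.2.map fun w => q.2 ++ w)
      (PT.map (h := fun q : ((α × List (List Bool)) × List Bool) × List Bool => q.1.2 ++ q.2)
        (PT.append.comp ((PT.snd.comp .fst).pair .snd)) (PT.snd.comp .fst)) (.const Q)
  have key : ∀ n, (fun W : List (List Bool) => Q.flatMap fun a => W.map fun w => a ++ w)^[n] [[]] =
      JohnsonClustering.words Q n := by
    intro n
    induction n with
    | zero => rfl
    | succ n ih => rw [Function.iterate_succ_apply', ih]; rfl
  have hpos : 1 ≤ Q.length := List.length_pos_iff.2 hQ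
  have := PT.iterateCtx hstep hx (.const [[]])
    (B := fun a => Q.length ^ (x a).length * (2 * (size (x a) * size Q) + 1))
    (h.mul (((PolyB.const 2).mul (hx.polyB.mul (.const _))).add (.const 1))) fun a n hn => by
      rw [key]
      refine (size_le_of_forall_length_le fun w hw =>
        length_of_mem_words (fun a => length_le_size_of_mem) hw).trans ?_
      rw [length_words, size_string]
      gcongr
  simpa only [key] using this

/-- The number of common ones. -/
def agree (u v : List Bool) : ℕ := (List.zipWith and u v).count true

/-- Move the first candidate to the code and drop the candidates that agree with it in at least
`e` places. -/
def pick (e : ℕ) (s : List (List Bool) × List (List Bool)) :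
    List (List Bool) × List (List Bool) :=
  (s.1.tail.filter fun w => agree (s.1.headD []) w < e, s.1.headD [] :: s.2)

/-- `m` greedily chosen members of `W`. -/
def greedy (e m : ℕ) (W : List (List Bool)) : List (List Bool) := ((pick e)^[m] (W, [])).2

theorem PT.greedy : PT (fun p : (List Bool × List Bool) × List (List Bool) =>
    JohnsonClustering.greedy p.1.1.length p.1.2.length p.2) := by
  have hF : PT (fun p : ((List Bool × List Bool) × List (List Bool)) ×
      (List (List Bool) × List (List Bool)) => pick p.1.1.1.length p.2) := by
    have hu := PT.uncons.comp (PT.fst.comp (PT.snd (α := (List Bool × List Bool) ×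
      List (List Bool)) (β := List (List Bool) × List (List Bool))))
    have hh := PT.fst.comp hu
    have hagree := PT.trues.comp ((PT.zipWith and).comp ((hh.comp
      (PT.fst (β := List Bool))).pair .snd))
    have he := PT.fst.comp (PT.fst.comp (PT.fst.comp (PT.fst (α := (((List Bool × List Bool) ×
      List (List Bool)) × (List (List Bool) × List (List Bool)))) (β := List Bool))))
    -- Removing as many symbols as there are agreements from a string of length `e` leaves something
    -- exactly when the agreement is less than `e`.
    have hf := PT.filter (PT.drop.comp (hagree.pair he)) (PT.snd.comp hu)
    refine (hf.pair (PT.listCons.comp (hh.pair (PT.snd.comp .snd)))).of_enc (fun a => a)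
      (fun _ => rfl) fun a => ?_
    congr 1
    unfold pick
    congr 1
    refine List.filter_congr fun w _ => ?_
    simp [JohnsonClustering.trues, agree]
  have := PT.iterateIncr hF (PT.snd.comp .fst) (PT.snd.pair (.const ([] : List (List Bool))))
    (PolyB.const 1) fun a s => by
      obtain ⟨W, C⟩ := s
      cases W with
      | nil =>
        simp only [pick, size_pair, size_cons, size_nil, List.tail_nil, List.filter_nil,
          List.headD_nil, List.length_nil]
        omega
      | cons w W =>
        have h1 : size (pick a.1.1.length (w :: W, C)).1 ≤ size W :=
          size_le_of_sublist List.filter_sublist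
        have h2 : (pick a.1.1.length (w :: W, C)).2 = w :: C := rfl
        rw [← Prod.mk.eta (p := pick _ _)]
        simp only [size_pair, size_cons, h2]
        omega
  exact PT.snd.comp this

/-- The union of the members of `C` that are selected by the bits of `row`. -/
def orRow (zero : List Bool) (C : List (List Bool)) (row : List Bool) : List Bool :=
  (row.foldl (fun s b => if b then (s.1.tail, List.zipWith or s.2 (s.1.headD []))
    else (s.1.tail, s.2)) (C, zero)).2

theorem PT.orRow : PT (fun p : (List Bool × List (List Bool)) × List Bool =>
    JohnsonClustering.orRow p.1.1 p.1.2 p.2) := by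
  have h2 : PT (fun p : ((List Bool × List (List Bool)) × List Bool) ×
    (List (List Bool) × List Bool) => p.2) := .snd
  have hu := PT.uncons.comp (PT.fst.comp h2)
  have ht : ∀ C : List (List Bool), size C.tail ≤ size C :=
    fun C => size_le_of_sublist (List.tail_sublist C)
  exact PT.snd.comp (PT.foldBitsIncr ((PT.snd.comp hu).pair (PT.snd.comp h2))
    ((PT.snd.comp hu).pair ((PT.zipWith or).comp ((PT.snd.comp h2).pair (PT.fst.comp hu))))
    .snd ((PT.snd.comp .fst).pair (PT.fst.comp .fst)) (PolyB.const 0)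
    (fun a s => by have := ht s.1; obtain ⟨C, v⟩ := s; simp only [size_pair] at *; omega)
    (fun a s => by
      have := ht s.1
      obtain ⟨C, v⟩ := s
      simp only [size_pair, size_string, List.length_zipWith] at *
      omega))

/-- One step of the search for a power of two that is at least `|m|`. -/
def logStep (m : List Bool) (s : List Bool × List Bool) : List Bool × List Bool :=
  if m.drop s.1.length = [] then s else (s.1 ++ s.1, true :: s.2)

/-- The exponent of a power of two between `|m|` and `2 |m| + 2`, in unary. -/
def logUnary (m : List Bool) : List Bool := ((logStep m)^[m.length] ([true, true], [true])).2

theorem PT.logUnary : PT logUnary := by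
  have h2 : PT (fun p : List Bool × (List Bool × List Bool) => p.2) := .snd
  have h21 := PT.fst.comp h2
  have hF : PT (fun p : List Bool × (List Bool × List Bool) => logStep p.1 p.2) :=
    .ifNil (PT.drop.comp (h21.pair .fst)) h2
      ((PT.append.comp (h21.pair h21)).pair ((PT.cons true).comp (PT.snd.comp h2)))
  exact PT.snd.comp (PT.iterateIncr hF .id (.const ([true, true], [true]))
    (c := fun m => 2 * size m + 1) (((PolyB.const 2).mul .size).add (.const 1)) fun m s => by
      obtain ⟨u, v⟩ := s
      unfold logStep
      split_ifs with h
      · exact Nat.le_add_right _ _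
      · simp only [List.drop_eq_nil_iff, not_le] at h
        simp only [size_pair, size_string, List.length_append, List.length_cons] at *
        omega)

/-- Doubling happens only below `|m|`, so the power never exceeds `2 * |m| + 2`, where the summand
`2` covers the starting value. Starting at `2 ^ 1` keeps the exponent positive. If `|m|` was not
reached after `|m|` rounds, every round doubled and the exponent is `|m| + 1`, which also suffices.
-/
theorem logUnary_spec (m : List Bool) : 1 ≤ (logUnary m).length ∧
    m.length ≤ 2 ^ (logUnary m).length ∧ 2 ^ (logUnary m).length ≤ 2 * m.length + 2 := by
  have key : ∀ n, 1 ≤ ((logStep m)^[n] ([true, true], [true])).2.length ∧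
      ((logStep m)^[n] ([true, true], [true])).1.length =
        2 ^ ((logStep m)^[n] ([true, true], [true])).2.length ∧
      ((logStep m)^[n] ([true, true], [true])).1.length ≤ 2 * m.length + 2 ∧
      (m.length ≤ ((logStep m)^[n] ([true, true], [true])).1.length ∨
        ((logStep m)^[n] ([true, true], [true])).2.length = n + 1) := by
    intro n
    induction n with
    | zero => simp
    | succ n ih =>
      rw [Function.iterate_succ_apply']
      generalize (logStep m)^[n] ([true, true], [true]) = s at ih ⊢
      obtain ⟨h1, h2, h3, h4⟩ := ih
      unfold logStep
      split_ifs with h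
      · simp only [List.drop_eq_nil_iff] at h
        exact ⟨h1, h2, h3, .inl h⟩
      · simp only [List.drop_eq_nil_iff, not_le] at h
        simp only [List.length_append, List.length_cons, pow_succ]
        refine ⟨by omega, by omega, by omega, by omega⟩
  obtain ⟨h1, h2, h3, h4⟩ := key m.length
  refine ⟨h1, ?_, h2 ▸ h3⟩
  rcases h4 with h4 | h4
  · exact h2 ▸ h4
  · unfold logUnary
    rw [h4]
    exact (Nat.lt_two_pow_self).le.trans (Nat.pow_le_pow_right (by norm_num) (by omega))

/-- The string with a single one, at place `a`. -/
def oneHot (q a : ℕ) : List Bool := (List.range q).map fun i => decide (i = a)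

/-- All strings of length `q` with a single one. -/
def blocks (q : ℕ) : List (List Bool) := (List.range q).map (oneHot q)

theorem length_blocks (q : ℕ) : (blocks q).length = q := by simp [blocks]

/-- The number of tag bits. -/
def tagLen (M : ℕ) (m : List Bool) : List Bool := rep M (logUnary m)

/-- The code of `|m|` words with alphabet size `2 ^ (M + 1)`. -/
def code (M : ℕ) (m : List Bool) : List (List Bool) :=
  greedy (tagLen M m).length m.length
    (words (blocks (2 ^ (M + 1))) (rep M (tagLen M m)).length)

/-- The length of the words of the code. -/
def codeLen (M : ℕ) (m : List Bool) : List Bool := rep (2 ^ (M + 1)) (rep M (tagLen M m))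

/-- The new points. -/
def newRows (M : ℕ) (m : List Bool) (rows : List (List Bool)) : List (List Bool) :=
  rows.flatMap fun T => (words [[true], [false]] (tagLen M m).length).map fun τ =>
    orRow (List.replicate (codeLen M m).length false) (code M m) T ++ τ

theorem PT.tagLen (M : ℕ) : PT (tagLen M) := (PT.rep M).comp .logUnary

theorem polyB_pow_logUnary (c : ℕ) : PolyB fun m => (2 ^ c) ^ (logUnary m).length := by
  refine ((((PolyB.const 2).mul .size).add (.const 2)).pow c).mono fun m => ?_
  rw [← pow_mul, mul_comm, pow_mul]
  exact Nat.pow_le_pow_left (logUnary_spec m).2.2 c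

theorem PT.code (M : ℕ) : PT (code M) := by
  have ht := PT.tagLen M
  have hb : blocks (2 ^ (M + 1)) ≠ [] := by
    rw [← List.length_pos_iff, length_blocks]; positivity
  have hw := PT.words (blocks (2 ^ (M + 1))) hb ((PT.rep M).comp ht) (by
    -- The alphabet has `2 ^ (M + 1)` letters and a word has `M * M` letters per unit of the
    -- logarithm.
    refine (polyB_pow_logUnary ((M + 1) * (M * M))).mono fun m => ?_
    rw [length_blocks, length_rep, JohnsonClustering.tagLen, length_rep]
    rw [← pow_mul, ← pow_mul]
    exact Nat.pow_le_pow_right (by norm_num) (by simp only [mul_assoc]; rfl))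
  exact PT.greedy.comp ((ht.pair .id).pair hw)

theorem PT.codeLen (M : ℕ) : PT (codeLen M) := (PT.rep _).comp ((PT.rep M).comp (.tagLen M))

theorem PT.newRows (M : ℕ) :
    PT (fun p : List Bool × List (List Bool) => newRows M p.1 p.2) := by
  have htag := PT.words [[true], [false]] (by simp) (PT.tagLen M) (by
    refine (polyB_pow_logUnary M).mono fun m => ?_
    rw [JohnsonClustering.tagLen, length_rep, pow_mul]; rfl)
  have hm : PT (fun p : ((List Bool × List (List Bool)) × List Bool) × List Bool => p.1.1.1) :=
    PT.fst.comp (PT.fst.comp .fst)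
  have ho := PT.orRow.comp (((PT.zeros.comp ((PT.codeLen M).comp hm)).pair
    ((PT.code M).comp hm)).pair (PT.snd.comp .fst))
  exact PT.flatMap (PT.map (h := fun q : ((List Bool × List (List Bool)) × List Bool) × List Bool =>
    JohnsonClustering.orRow (List.replicate (JohnsonClustering.codeLen M q.1.1.1).length false)
      (JohnsonClustering.code M q.1.1.1) q.1.2 ++ q.2)
    (PT.append.comp (ho.pair .snd)) (htag.comp (PT.fst.comp .fst))) .snd

/-! ### Parsing -/

/-- Two numbers and a list of rows. -/
structure RawInput where
  m : ℕ
  k : ℕ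
  rows : List (List Bool)

instance : Enc RawInput :=
  ⟨fun r => encodeUnary r.m ++ encodeUnary r.k ++ r.rows.flatMap encodeRow⟩

/-- One step of splitting a leading unary number from a string. -/
def splitStep (s : List Bool × (List Bool × List Bool)) (b : Bool) :
    List Bool × (List Bool × List Bool) :=
  if b then (if s.1 = [] then ([], (true :: s.2.1, s.2.2)) else (s.1, (s.2.1, s.2.2 ++ [true])))
  else (if s.1 = [] then ([true], s.2) else (s.1, (s.2.1, s.2.2 ++ [false])))

/-- Split a leading unary number from a string. -/
def splitUnary (x : List Bool) : List Bool × List Bool := (x.foldl splitStep ([], [], [])).2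

/-- The first component of the state is empty until the end mark has been read. The number is
accumulated in reverse, which is harmless for a constant string. -/
theorem splitUnary_encode (m : ℕ) (x : List Bool) :
    splitUnary (encodeUnary m ++ x) = (List.replicate m true, x) := by
  have h1 : ∀ m u, (List.replicate m true).foldl splitStep ([], u, []) =
      ([], List.replicate m true ++ u, []) := by
    intro m
    induction m with
    | zero => intro u; rfl
    | succ m ih =>
      intro u
      rw [List.replicate_succ, List.foldl_cons]
      have : splitStep ([], u, []) true = ([], true :: u, []) := rfl
      rw [this, ih, ← List.replicate_succ, List.replicate_succ']
      simp
  have h2 : ∀ x u v : List Bool, x.foldl splitStep ([true], u, v) = ([true], u, v ++ x) := by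
    intro x
    induction x with
    | nil => intro u v; simp
    | cons b x ih =>
      intro u v
      have : splitStep ([true], u, v) b = ([true], u, v ++ [b]) := by cases b <;> simp [splitStep]
      rw [List.foldl_cons, this, ih]; simp
  have h3 : ∀ u, splitStep ([], u, []) false = ([true], u, []) := fun u => rfl
  simp only [splitUnary, encodeUnary, List.foldl_append, h1, List.foldl_cons, h3,
    h2]
  simp

theorem PT.splitUnary : PT splitUnary := by
  have h2 : PT (fun p : List Bool × (List Bool × (List Bool × List Bool)) => p.2) := .snd
  have h21 := PT.fst.comp h2
  have h22 := PT.snd.comp h2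
  have h221 := PT.fst.comp h22
  have h222 := PT.snd.comp h22
  have ha : ∀ b : Bool, PT fun p : List Bool × (List Bool × (List Bool × List Bool)) =>
      (p.2.1, (p.2.2.1, p.2.2.2 ++ [b])) := fun b =>
    h21.pair (h221.pair (PT.append.comp (h222.pair (.const [b]))))
  have hF : PT fun p : List Bool × (List Bool × (List Bool × List Bool)) =>
      splitStep p.2 false := by
    exact .ifNil h21 (PT.pair (.const [true]) h22) (ha false)
  have hG : PT fun p : List Bool × (List Bool × (List Bool × List Bool)) =>
      splitStep p.2 true := by
    exact .ifNil h21 (PT.pair (.const []) (((PT.cons true).comp h221).pair h222)) (ha true)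
  have hs : ∀ (a : List Bool) (b : Bool) s, size (splitStep s b) ≤ size s + 2 := by
    intro a b s
    obtain ⟨u, v, w⟩ := s
    simp only [splitStep]
    split_ifs with _ h <;> simp only [size_pair, size_string, List.length_cons, List.length_append,
      List.length_nil] <;> (try subst h) <;> (try simp only [List.length_nil]) <;> omega
  have := PT.foldBitsIncr hF hG .id (.const (([] : List Bool), ([] : List Bool), ([] : List Bool)))
    (PolyB.const 2) (fun a s => hs a _ _) (fun a s => hs a _ _)
  have h := PT.snd.comp this
  convert h using 2 with x
  unfold JohnsonClustering.splitUnary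
  congr 2

theorem PT.parse : PT fun r : RawInput =>
    (List.replicate r.m true, (List.replicate r.k true, r.rows)) := by
  have hs := PT.snd.comp .splitUnary
  refine PT.of_enc (F := fun x => ((JohnsonClustering.splitUnary x).1,
      JohnsonClustering.splitUnary (JohnsonClustering.splitUnary x).2))
    ((PT.fst.comp .splitUnary).pair (PT.splitUnary.comp hs)) (fun r => enc r) (fun _ => rfl)
    fun r => ?_
  have : enc r = encodeUnary r.m ++ (encodeUnary r.k ++ r.rows.flatMap encodeRow) :=
    List.append_assoc _ _ _
  simp only [this, splitUnary_encode]
  rfl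

/-- The reduction from Johnson Coverage to clustering. -/
def reduce (M : ℕ) (r : RawInput) : RawInput where
  m := (codeLen M (List.replicate r.m true)).length + (tagLen M (List.replicate r.m true)).length
  k := r.k
  rows := newRows M (List.replicate r.m true) r.rows

/-- The lengths computed so far must be strings of `true` only, because they are output literally as
the unary dimension. -/
theorem logUnary_eq (m : List Bool) :
    logUnary m = List.replicate (logUnary m).length true := by
  have : ∀ n, ∀ b ∈ ((logStep m)^[n] ([true, true], [true])).2, b = true := by
    intro n
    induction n with
    | zero => simp
    | succ n ih =>
      rw [Function.iterate_succ_apply']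
      unfold logStep
      split_ifs
      · exact ih
      · intro b hb
        rcases List.mem_cons.1 hb with h | h
        · exact h
        · exact ih b h
  exact List.eq_replicate_of_mem (this _)

theorem rep_replicate (n m : ℕ) :
    rep n (List.replicate m true) = List.replicate (n * m) true := by
  simp [rep]

theorem tagLen_eq (M : ℕ) (m : List Bool) :
    tagLen M m = List.replicate (tagLen M m).length true := by
  rw [tagLen, logUnary_eq, rep_replicate, List.length_replicate]

theorem codeLen_eq (M : ℕ) (m : List Bool) :
    codeLen M m = List.replicate (codeLen M m).length true := by
  rw [codeLen, tagLen_eq, rep_replicate, rep_replicate, List.length_replicate]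

theorem PT.reduce (M : ℕ) : PT (reduce M) := by
  have hp := PT.parse
  have hm := PT.fst.comp hp
  have hk := PT.fst.comp (PT.snd.comp hp)
  have hr := PT.snd.comp (PT.snd.comp hp)
  have hd := PT.append.comp ((PT.append.comp (((PT.codeLen M).comp hm).pair
    ((PT.tagLen M).comp hm))).pair (.const [false]))
  have hk' := PT.append.comp (hk.pair (.const [false]))
  have hrows := PT.flat.comp ((PT.newRows M).comp (hm.pair hr))
  refine (PT.append.comp ((PT.append.comp (hd.pair hk')).pair hrows)).of_enc (fun r => r)
    (fun _ => rfl) fun r => ?_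
  have : ∀ a b : ℕ, List.replicate a true ++ List.replicate b true = List.replicate (a + b) true :=
    fun a b => by simp
  change _ = encodeUnary _ ++ encodeUnary _ ++ _
  rw [enc_string]
  simp only [encodeUnary, JohnsonClustering.reduce]
  rw [codeLen_eq, tagLen_eq, this]
  simp only [List.length_replicate]

end JohnsonClustering

/-! ### Combinatorics of soundness and the geometry of the embedding -/

namespace JohnsonClustering

/-! ### Intersecting families -/

theorem card_supersets_le {m z r : ℕ} (R : Finset (Fin m)) (hR : R.card = r) :
    ((Finset.univ.powersetCard z).filter fun T => R ⊆ T).card ≤ m ^ (z - r) := by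
  have h : ((Finset.univ.powersetCard z).filter fun T => R ⊆ T).card ≤
      ((Finset.univ : Finset (Fin m)).powersetCard (z - r)).card := by
    refine Finset.card_le_card_of_injOn (fun T => T \ R) (fun T hT => ?_) fun T hT T' hT' h => ?_
    · simp only [Finset.coe_filter, Finset.mem_powersetCard, Set.mem_ofPred_eq] at hT
      simp [Finset.card_sdiff_of_subset hT.2, hR, hT.1.2]
    · simp only [Finset.coe_filter, Set.mem_ofPred_eq] at hT hT'
      rw [← Finset.sdiff_union_of_subset hT.2, ← Finset.sdiff_union_of_subset hT'.2]
      exact congrArg (· ∪ R) h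
  refine h.trans ?_
  rw [Finset.card_powersetCard, Finset.card_fin]
  exact Nat.choose_le_pow _ _

/-- Fix a member `T₁`. Every member contains one of the at most `2 ^ z` subsets of `T₁` of size `y +
1`, and each of these has at most `m ^ (z - y - 1)` supersets of size `z`. -/
theorem card_le_of_intersecting_succ {m z y : ℕ} (B : Finset (Finset (Fin m)))
    (hB : ∀ T ∈ B, T.card = z) (h : ∀ T ∈ B, ∀ T' ∈ B, y + 1 ≤ (T ∩ T').card) :
    B.card ≤ 2 ^ z * m ^ (z - y - 1) := by
  rcases B.eq_empty_or_nonempty with rfl | ⟨T₁, hT₁⟩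
  · simp
  have hsub : B ⊆ (T₁.powersetCard (y + 1)).biUnion fun R =>
      (Finset.univ.powersetCard z).filter fun T => R ⊆ T := by
    intro T hT
    obtain ⟨R, hR, hRc⟩ := Finset.exists_subset_card_eq (h T₁ hT₁ T hT)
    refine Finset.mem_biUnion.2 ⟨R, Finset.mem_powersetCard.2
      ⟨hR.trans Finset.inter_subset_left, hRc⟩, ?_⟩
    simp [hB T hT, hR.trans Finset.inter_subset_right]
  refine (Finset.card_le_card hsub).trans ((Finset.card_biUnion_le_card_mul _ _ (m ^ (z - y - 1))
    fun R hR => ?_).trans ?_)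
  · exact card_supersets_le R (Finset.mem_powersetCard.1 hR).2
  · gcongr
    rw [Finset.card_powersetCard, hB _ hT₁]
    exact Nat.choose_le_two_pow _ _

/-- Fix a member `T₁`; every member `T` contains a `y`-subset `S` of it. If no `y`-set is common to
all, some member `f S` does not contain `S`. Since `T` meets `f S` in at least `y` elements, it
contains some `u ∈ f S \ S`, hence the `(y + 1)`-set `insert u S`. There are at most `2 ^ z` choices
of `S` and `z` of `u`. -/
theorem common_subset_or_card_le {m z y : ℕ} (B : Finset (Finset (Fin m)))
    (hB : ∀ T ∈ B, T.card = z) (h : ∀ T ∈ B, ∀ T' ∈ B, y ≤ (T ∩ T').card) :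
    (∃ S : Finset (Fin m), S.card = y ∧ ∀ T ∈ B, S ⊆ T) ∨
      B.card ≤ 2 ^ z * z * m ^ (z - y - 1) := by
  rcases B.eq_empty_or_nonempty with rfl | ⟨T₁, hT₁⟩
  · right; simp
  by_cases hS : ∃ S : Finset (Fin m), S.card = y ∧ ∀ T ∈ B, S ⊆ T
  · exact .inl hS
  right
  push Not at hS
  choose! f hf hf' using hS
  have hsub : B ⊆ (T₁.powersetCard y).biUnion fun S => (f S \ S).biUnion fun u =>
      (Finset.univ.powersetCard z).filter fun T => insert u S ⊆ T := by
    intro T hT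
    obtain ⟨S, hS, hSc⟩ := Finset.exists_subset_card_eq (h T₁ hT₁ T hT)
    have hST := hS.trans Finset.inter_subset_right
    obtain ⟨u, hu, huS⟩ : ∃ u ∈ T ∩ f S, u ∉ S := by
      -- Otherwise `T ∩ f S` lies in `S` and has at least `|S|` elements, so it equals `S`, and `S ⊆
      -- f S`.
      by_contra! hcon
      have hle := h T hT (f S) (hf S hSc)
      have : T ∩ f S = S := Finset.eq_of_subset_of_card_le hcon (by omega)
      have hsub : T ∩ f S ⊆ f S := Finset.inter_subset_right
      rw [this] at hsub
      exact hf' S hSc hsub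
    rw [Finset.mem_inter] at hu
    refine Finset.mem_biUnion.2 ⟨S, Finset.mem_powersetCard.2
      ⟨hS.trans Finset.inter_subset_left, hSc⟩, Finset.mem_biUnion.2 ⟨u, ?_, ?_⟩⟩
    · simp [hu.2, huS]
    · simp [hB T hT, Finset.insert_subset_iff, hu.1, hST]
  refine (Finset.card_le_card hsub).trans ((Finset.card_biUnion_le_card_mul _ _
    (z * m ^ (z - y - 1)) fun S hS => ?_).trans ?_)
  · have hSc := (Finset.mem_powersetCard.1 hS).2
    refine (Finset.card_biUnion_le_card_mul _ _ (m ^ (z - y - 1)) fun u hu => ?_).trans ?_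
    · rw [Nat.sub_sub]
      refine card_supersets_le _ ?_
      rw [Finset.card_insert_of_notMem (Finset.mem_sdiff.1 hu).2, hSc]
    · gcongr
      exact (Finset.card_le_card Finset.sdiff_subset).trans (hB _ (hf S hSc)).le
  · rw [mul_assoc]
    gcongr
    rw [Finset.card_powersetCard, hB _ hT₁]
    exact Nat.choose_le_two_pow _ _

/-! ### The lower bound for one family of points -/

theorem sub_mul_le_of_hammingDist_lt {z i a L d : ℕ} {u v c : Fin d → Bool}
    (h : 2 * (z - i) * L ≤ hammingDist u v) (hu : hammingDist u c < a * L)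
    (hv : hammingDist v c < a * L) : z - i < a := by
  by_contra! hcon
  have h1 := hammingDist_triangle u c v
  rw [hammingDist_comm c v] at h1
  have := Nat.mul_le_mul_right L hcon
  rw [mul_assoc] at h
  omega

/-- The sets near one center meet pairwise in at least `y + 1` elements. The bound carries a
superfluous factor `z`, so that one error term serves both radii. -/
theorem card_near_le {m z y d k L : ℕ} (hyz : y < z) (E : Finset (Finset (Fin m)))
    (hE : ∀ T ∈ E, T.card = z) (φ : Finset (Fin m) → Fin d → Bool)
    (hφ : ∀ T ∈ E, ∀ T' ∈ E, 2 * (z - (T ∩ T').card) * L ≤ hammingDist (φ T) (φ T'))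
    (c : Fin k → Fin d → Bool) :
    (E.filter fun T => ∃ i, hammingDist (φ T) (c i) < (z - y) * L).card ≤
      k * (2 ^ z * z * m ^ (z - y - 1)) := by
  have hsub : (E.filter fun T => ∃ i, hammingDist (φ T) (c i) < (z - y) * L) ⊆
      Finset.univ.biUnion fun i => E.filter fun T => hammingDist (φ T) (c i) < (z - y) * L := by
    intro T hT
    obtain ⟨hT, i, hi⟩ := Finset.mem_filter.1 hT
    exact Finset.mem_biUnion.2 ⟨i, Finset.mem_univ _, Finset.mem_filter.2 ⟨hT, hi⟩⟩
  refine (Finset.card_le_card hsub).trans ((Finset.card_biUnion_le_card_mul _ _ _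
    fun i _ => ?_).trans_eq (by rw [Finset.card_fin]))
  refine (card_le_of_intersecting_succ (y := y) _ (fun T hT => hE T (Finset.mem_filter.1 hT).1)
    fun T hT T' hT' => ?_).trans ?_
  · obtain ⟨hT, hTi⟩ := Finset.mem_filter.1 hT
    obtain ⟨hT', hTi'⟩ := Finset.mem_filter.1 hT'
    have := sub_mul_le_of_hammingDist_lt (hφ T hT T' hT') hTi hTi'
    omega
  · exact Nat.mul_le_mul_right _ (Nat.le_mul_of_pos_right _ (by omega))

/-- The sets near one center meet pairwise in at least `y` elements. If they share a `y`-set, that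
set is chosen and nothing is missed; otherwise there are few of them and any `y`-set will do. -/
theorem exists_card_near_succ_le {m z y d k L : ℕ} (hyz : y < z) (E : Finset (Finset (Fin m)))
    (hne : E.Nonempty)
    (hE : ∀ T ∈ E, T.card = z) (φ : Finset (Fin m) → Fin d → Bool)
    (hφ : ∀ T ∈ E, ∀ T' ∈ E, 2 * (z - (T ∩ T').card) * L ≤ hammingDist (φ T) (φ T'))
    (c : Fin k → Fin d → Bool) : ∃ S : Fin k → Finset (Fin m), (∀ i, (S i).card = y) ∧
    (E.filter fun T => ∃ i, hammingDist (φ T) (c i) < (z - y + 1) * L).card ≤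
      (covUnion S E).card + k * (2 ^ z * z * m ^ (z - y - 1)) := by
  classical
  set B : Fin k → Finset (Finset (Fin m)) := fun i =>
    E.filter fun T => hammingDist (φ T) (c i) < (z - y + 1) * L
  have hB : ∀ i, ∃ S : Finset (Fin m), S.card = y ∧
      (B i \ cov S E).card ≤ 2 ^ z * z * m ^ (z - y - 1) := by
    intro i
    rcases common_subset_or_card_le (y := y) (B i)
      (fun T hT => hE T (Finset.mem_filter.1 hT).1) (fun T hT T' hT' => by
        obtain ⟨hT, hTi⟩ := Finset.mem_filter.1 hT
        obtain ⟨hT', hTi'⟩ := Finset.mem_filter.1 hT'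
        have := sub_mul_le_of_hammingDist_lt (hφ T hT T' hT') hTi hTi'
        omega) with ⟨S, hS, hSB⟩ | h
    · refine ⟨S, hS, ?_⟩
      have : B i \ cov S E = ∅ := by
        rw [Finset.sdiff_eq_empty_iff_subset]
        exact fun T hT => Finset.mem_filter.2 ⟨(Finset.mem_filter.1 hT).1, hSB T hT⟩
      simp [this]
    · obtain ⟨T, hT⟩ := hne
      obtain ⟨S, _, hS⟩ := Finset.exists_subset_card_eq (s := T) (n := y) (by rw [hE T hT]; omega)
      exact ⟨S, hS, (Finset.card_le_card Finset.sdiff_subset).trans h⟩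
  choose S hS hSB using hB
  refine ⟨S, hS, ?_⟩
  have hsub : (E.filter fun T => ∃ i, hammingDist (φ T) (c i) < (z - y + 1) * L) ⊆
      covUnion S E ∪ Finset.univ.biUnion fun i => B i \ cov (S i) E := by
    intro T hT
    obtain ⟨hT, i, hi⟩ := Finset.mem_filter.1 hT
    by_cases hc : T ∈ cov (S i) E
    · exact Finset.mem_union_left _ (Finset.mem_biUnion.2 ⟨i, Finset.mem_univ _, hc⟩)
    · exact Finset.mem_union_right _ (Finset.mem_biUnion.2 ⟨i, Finset.mem_univ _,
        Finset.mem_sdiff.2 ⟨Finset.mem_filter.2 ⟨hT, hi⟩, hc⟩⟩)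
  refine (Finset.card_le_card hsub).trans ((Finset.card_union_le _ _).trans ?_)
  gcongr
  exact (Finset.card_biUnion_le_card_mul _ _ _ fun i _ => hSB i).trans_eq (by rw [Finset.card_fin])

/-- A point costs at least `((w + 1) * L) ^ t` unless it is one of at most `(α + κ) * |E|` points,
and then at least `(w * L) ^ t` unless it is one of at most `κ * |E|` points. Here `κ` measures the
exceptional families against `|E|`; the centers are arbitrary. -/
theorem layer_cost_ge {m z y d k L t : ℕ} (hyz : y < z)
    (E : Finset (Finset (Fin m)))
    (hne : E.Nonempty)
    (hE : ∀ T ∈ E, T.card = z) (φ : Finset (Fin m) → Fin d → Bool)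
    (hφ : ∀ T ∈ E, ∀ T' ∈ E, 2 * (z - (T ∩ T').card) * L ≤ hammingDist (φ T) (φ T'))
    (c : Fin k → Fin d → Bool) {α κ : ℝ}
    (hα : ∀ S : Fin k → Finset (Fin m), (∀ i, (S i).card = y) →
      ((covUnion S E).card : ℝ) ≤ α * E.card)
    (hκ : ((k * (2 ^ z * z * m ^ (z - y - 1)) : ℕ) : ℝ) ≤ κ * E.card)
    (r : Finset (Fin m) → ℕ) (hr : ∀ T ∈ E, ∃ i, r T = hammingDist (φ T) (c i)) :
    (((z - y : ℕ) + 1 : ℝ) ^ t - (((z - y : ℕ) + 1 : ℝ) ^ t - ((z - y : ℕ) : ℝ) ^ t) * (α + κ) -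
      ((z - y : ℕ) : ℝ) ^ t * κ) * E.card * (L : ℝ) ^ t ≤ ∑ T ∈ E, (r T : ℝ) ^ t := by
  set w := z - y with hw
  obtain ⟨S, hS, hX⟩ := exists_card_near_succ_le hyz E hne hE φ hφ c
  have hY := card_near_le hyz E hE φ hφ c
  rw [← hw] at hX hY
  have hX' : ((E.filter fun T => r T < (w + 1) * L).card : ℝ) ≤ (α + κ) * E.card := by
    have h1 : (E.filter fun T => r T < (w + 1) * L).card ≤
        (E.filter fun T => ∃ i, hammingDist (φ T) (c i) < (w + 1) * L).card := by
      refine Finset.card_le_card fun T hT => ?_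
      obtain ⟨hT, h⟩ := Finset.mem_filter.1 hT
      obtain ⟨i, hi⟩ := hr T hT
      exact Finset.mem_filter.2 ⟨hT, i, hi ▸ h⟩
    have h2 : ((E.filter fun T => r T < (w + 1) * L).card : ℝ) ≤ (covUnion S E).card +
        ((k * (2 ^ z * z * m ^ (w - 1)) : ℕ) : ℝ) := by exact_mod_cast h1.trans hX
    have := hα S hS
    linarith
  have hY' : ((E.filter fun T => r T < w * L).card : ℝ) ≤ κ * E.card := by
    have h1 : (E.filter fun T => r T < w * L).card ≤
        (E.filter fun T => ∃ i, hammingDist (φ T) (c i) < w * L).card := by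
      refine Finset.card_le_card fun T hT => ?_
      obtain ⟨hT, h⟩ := Finset.mem_filter.1 hT
      obtain ⟨i, hi⟩ := hr T hT
      exact Finset.mem_filter.2 ⟨hT, i, hi ▸ h⟩
    have h2 : ((E.filter fun T => r T < w * L).card : ℝ) ≤
        ((k * (2 ^ z * z * m ^ (w - 1)) : ℕ) : ℝ) := by exact_mod_cast h1.trans hY
    linarith
  -- The staircase with jumps at `w * L` and `(w + 1) * L` lies below the `t`-th power; written with
  -- indicators, its sum is linear in the two counts.
  have hpoint : ∀ T ∈ E, ((w + 1 : ℝ) ^ t - ((w + 1 : ℝ) ^ t - (w : ℝ) ^ t) *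
      (if r T < (w + 1) * L then 1 else 0) - (w : ℝ) ^ t * (if r T < w * L then 1 else 0)) *
      (L : ℝ) ^ t ≤ (r T : ℝ) ^ t := by
    intro T _
    split_ifs with h1 h2 h2
    · simp only [mul_one, sub_sub_cancel, sub_self, zero_mul]
      positivity
    · simp only [mul_one, sub_sub_cancel, mul_zero, sub_zero, ← mul_pow]
      have : ((w * L : ℕ) : ℝ) ≤ r T := by exact_mod_cast not_lt.1 h2
      push_cast at this
      gcongr
    · exact absurd (h2.trans_le (Nat.mul_le_mul_right L (Nat.le_succ w))) h1
    · simp only [mul_zero, sub_zero, ← mul_pow]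
      have : (((w + 1) * L : ℕ) : ℝ) ≤ r T := by exact_mod_cast not_lt.1 h1
      push_cast at this
      gcongr
  refine le_trans ?_ (Finset.sum_le_sum hpoint)
  rw [← Finset.sum_mul, Finset.sum_sub_distrib, Finset.sum_sub_distrib, ← Finset.mul_sum,
    ← Finset.mul_sum, Finset.sum_const, Finset.sum_boole, Finset.sum_boole, nsmul_eq_mul]
  refine mul_le_mul_of_nonneg_right ?_ (by positivity)
  have hmono : (0 : ℝ) ≤ (w + 1 : ℝ) ^ t - (w : ℝ) ^ t :=
    sub_nonneg.2 (pow_le_pow_left₀ (by positivity) (by linarith) t)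
  have h1 := mul_le_mul_of_nonneg_left hX' hmono
  have h2 := mul_le_mul_of_nonneg_left hY' (show (0 : ℝ) ≤ (w : ℝ) ^ t by positivity)
  linarith

/-! ### Unions of almost disjoint sets -/

/-- Each word keeps at least `L - 2 * z * e` private ones after removing those of the other words of
`T ∪ T'`, fewer than `2 * z` in relevant cases. The private parts of the elements of `T \ T'` are
disjoint and avoid the union over `T'`. -/
theorem card_biUnion_sdiff_ge {m z L e : ℕ} (C : Fin m → Finset ℕ) (hC : ∀ u, (C u).card = L)
    (he : ∀ u v, u ≠ v → (C u ∩ C v).card ≤ e) (T T' : Finset (Fin m)) (hT : T.card = z)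
    (hT' : T'.card = z) :
    (z - (T ∩ T').card) * (L - 2 * z * e) ≤ (T.biUnion C \ T'.biUnion C).card := by
  set D : Fin m → Finset ℕ := fun u => C u \ ((T ∪ T').erase u).biUnion C
  have hD : ∀ u, L - 2 * z * e ≤ (D u).card := by
    intro u
    have h1 : (C u ∩ ((T ∪ T').erase u).biUnion C).card ≤ 2 * z * e := by
      rw [Finset.inter_biUnion]
      refine (Finset.card_biUnion_le_card_mul _ _ e fun v hv =>
        he u v (Finset.ne_of_mem_erase hv).symm).trans ?_
      gcongr
      have := Finset.card_union_le T T'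
      have := Finset.card_le_card (Finset.erase_subset u (T ∪ T'))
      omega
    have h2 := Finset.card_sdiff_add_card_inter (C u) (((T ∪ T').erase u).biUnion C)
    rw [hC] at h2
    change L - 2 * z * e ≤ (C u \ _).card
    omega
  have hdisj : ∀ u ∈ T \ T', ∀ v ∈ T \ T', u ≠ v → Disjoint (D u) (D v) := by
    intro u hu v hv huv
    refine Finset.disjoint_left.2 fun i hi hi' => ?_
    refine (Finset.mem_sdiff.1 hi).2 (Finset.mem_biUnion.2 ⟨v, ?_, (Finset.mem_sdiff.1 hi').1⟩)
    exact Finset.mem_erase.2 ⟨huv.symm, Finset.mem_union_left _ (Finset.mem_sdiff.1 hv).1⟩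
  have hsub : (T \ T').biUnion D ⊆ T.biUnion C \ T'.biUnion C := by
    intro i hi
    obtain ⟨u, hu, hi⟩ := Finset.mem_biUnion.1 hi
    obtain ⟨hu, hu'⟩ := Finset.mem_sdiff.1 hu
    obtain ⟨hi, hi'⟩ := Finset.mem_sdiff.1 hi
    refine Finset.mem_sdiff.2 ⟨Finset.mem_biUnion.2 ⟨u, hu, hi⟩, fun h => hi' ?_⟩
    obtain ⟨v, hv, hiv⟩ := Finset.mem_biUnion.1 h
    exact Finset.mem_biUnion.2 ⟨v, Finset.mem_erase.2 ⟨fun h => hu' (h ▸ hv),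
      Finset.mem_union_right _ hv⟩, hiv⟩
  refine le_trans ?_ (Finset.card_le_card hsub)
  rw [Finset.card_biUnion hdisj]
  have hcard : (T \ T').card = z - (T ∩ T').card := by
    have := Finset.card_sdiff_add_card_inter T T'
    omega
  rw [← hcard]
  simpa using Finset.card_nsmul_le_sum (T \ T') (fun u => (D u).card) _ fun u _ => hD u

theorem card_biUnion_symmDiff_ge {m z L e : ℕ} (C : Fin m → Finset ℕ) (hC : ∀ u, (C u).card = L)
    (he : ∀ u v, u ≠ v → (C u ∩ C v).card ≤ e) (T T' : Finset (Fin m)) (hT : T.card = z)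
    (hT' : T'.card = z) :
    2 * (z - (T ∩ T').card) * (L - 2 * z * e) ≤ (symmDiff (T.biUnion C) (T'.biUnion C)).card := by
  have h1 := card_biUnion_sdiff_ge C hC he T T' hT hT'
  have h2 := card_biUnion_sdiff_ge C hC he T' T hT' hT
  rw [Finset.inter_comm] at h2
  have h3 : (symmDiff (T.biUnion C) (T'.biUnion C)).card =
      (T.biUnion C \ T'.biUnion C).card + (T'.biUnion C \ T.biUnion C).card := by
    rw [symmDiff_def, Finset.sup_eq_union, Finset.card_union_of_disjoint disjoint_sdiff_sdiff]
  rw [h3, mul_assoc]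
  omega

/-- Only the words of elements of `T \ S` can contribute, whether or not the words overlap. -/
theorem card_biUnion_symmDiff_le {m L : ℕ} (C : Fin m → Finset ℕ) (hC : ∀ u, (C u).card = L)
    {S T : Finset (Fin m)} (h : S ⊆ T) :
    (symmDiff (T.biUnion C) (S.biUnion C)).card ≤ (T.card - S.card) * L := by
  have hsub : symmDiff (T.biUnion C) (S.biUnion C) ⊆ (T \ S).biUnion C := by
    intro i hi
    rw [Finset.mem_symmDiff] at hi
    rcases hi with ⟨hi, hi'⟩ | ⟨hi, hi'⟩
    · obtain ⟨u, hu, hiu⟩ := Finset.mem_biUnion.1 hi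
      refine Finset.mem_biUnion.2 ⟨u, Finset.mem_sdiff.2 ⟨hu, fun huS => hi' ?_⟩, hiu⟩
      exact Finset.mem_biUnion.2 ⟨u, huS, hiu⟩
    · exact absurd (Finset.biUnion_subset_biUnion_of_subset_left C h hi) hi'
  refine (Finset.card_le_card hsub).trans ((Finset.card_biUnion_le_card_mul _ _ L
    fun u _ => (hC u).le).trans_eq ?_)
  rw [Finset.card_sdiff_of_subset h]

end JohnsonClustering

namespace JohnsonClustering

/-! ### Supports of strings -/

/-- The places of the ones. -/
def supp (l : List Bool) : Finset ℕ :=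
  (Finset.range l.length).filter fun i => l.getD i false = true

theorem mem_supp {l : List Bool} {i : ℕ} : i ∈ supp l ↔ l.getD i false = true := by
  simp only [supp, Finset.mem_filter, Finset.mem_range, and_iff_right_iff_imp]
  intro h
  by_contra hi
  rw [List.getD_eq_default _ _ (not_lt.1 hi)] at h
  simp at h

theorem lt_length_of_mem_supp {l : List Bool} {i : ℕ} (h : i ∈ supp l) : i < l.length :=
  Finset.mem_range.1 (Finset.mem_filter.1 h).1

theorem card_supp (l : List Bool) : (supp l).card = l.count true := by
  induction l with
  | nil => rfl
  | cons b l ih =>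
    have h : supp (b :: l) = (if b then {0} else ∅) ∪
        (supp l).map ⟨Nat.succ, Nat.succ_injective⟩ := by
      ext i
      rcases i with _ | i <;> cases b <;> simp [mem_supp]
    rw [h, Finset.card_union_of_disjoint, Finset.card_map, ih]
    · cases b <;> simp [add_comm]
    · cases b <;> simp

theorem supp_zipWith_and (u v : List Bool) : supp (List.zipWith and u v) = supp u ∩ supp v := by
  ext i
  simp only [Finset.mem_inter, mem_supp, List.getD_eq_getElem?_getD, List.getElem?_zipWith]
  cases u[i]? <;> cases v[i]? <;> simp

theorem supp_zipWith_or {u v : List Bool} (h : u.length = v.length) :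
    supp (List.zipWith or u v) = supp u ∪ supp v := by
  ext i
  simp only [Finset.mem_union, mem_supp, List.getD_eq_getElem?_getD, List.getElem?_zipWith]
  by_cases hi : i < u.length
  · rw [List.getElem?_eq_getElem hi, List.getElem?_eq_getElem (h ▸ hi)]; simp
  · rw [List.getElem?_eq_none (not_lt.1 hi), List.getElem?_eq_none (h ▸ not_lt.1 hi)]; simp

theorem agree_eq_card (u v : List Bool) : agree u v = (supp u ∩ supp v).card := by
  rw [agree, ← card_supp, supp_zipWith_and]

theorem supp_replicate_false (n : ℕ) : supp (List.replicate n false) = ∅ := by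
  refine Finset.eq_empty_of_forall_notMem fun i hi => ?_
  simp only [mem_supp, List.getD_eq_getElem?_getD, List.getElem?_replicate] at hi
  split_ifs at hi <;> simp at hi

/-- The string `l` as a vector. -/
def vec (d : ℕ) (l : List Bool) : Fin d → Bool := fun i => l.getD i false

theorem vec_injOn {d : ℕ} {u v : List Bool} (hu : u.length = d) (hv : v.length = d)
    (h : vec d u = vec d v) : u = v := by
  subst hu
  refine List.ext_getElem hv.symm fun i h1 h2 => ?_
  have := congrFun h ⟨i, h1⟩
  simpa [vec, h1, h2] using this

theorem ofFn_vec {d : ℕ} {u : List Bool} (hu : u.length = d) : List.ofFn (vec d u) = u := by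
  subst hu
  refine List.ext_getElem (by simp) fun i h1 h2 => ?_
  simp [vec, h2]

theorem hammingDist_vec {d : ℕ} {u v : List Bool} (hu : u.length = d) (hv : v.length = d) :
    hammingDist (vec d u) (vec d v) = (symmDiff (supp u) (supp v)).card := by
  refine Finset.card_bij (fun i _ => (i : ℕ)) (fun i hi => ?_) (fun i _ j _ h => Fin.ext h)
    fun i hi => ?_
  · have hi : u.getD i false ≠ v.getD i false := by simpa [vec] using hi
    rw [Finset.mem_symmDiff, mem_supp, mem_supp]
    revert hi
    cases u.getD i false <;> cases v.getD i false <;> simp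
  · have hid : i < d := by
      rw [Finset.mem_symmDiff] at hi
      rcases hi with ⟨h, _⟩ | ⟨h, _⟩
      · exact hu ▸ lt_length_of_mem_supp h
      · exact hv ▸ lt_length_of_mem_supp h
    refine ⟨⟨i, hid⟩, ?_, rfl⟩
    rw [Finset.mem_symmDiff, mem_supp, mem_supp] at hi
    have hne : u.getD i false ≠ v.getD i false := by
      revert hi
      cases u.getD i false <;> cases v.getD i false <;> simp
    simpa [vec] using hne

theorem getD_append_of_lt {u v : List Bool} {i : ℕ} (h : i < u.length) :
    (u ++ v).getD i false = u.getD i false := by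
  simp only [List.getD_eq_getElem?_getD, List.getElem?_append_left h]

theorem card_symmDiff_append_ge (u v τ : List Bool) (h : u.length = v.length) :
    (symmDiff (supp u) (supp v)).card ≤ (symmDiff (supp (u ++ τ)) (supp (v ++ τ))).card := by
  refine Finset.card_le_card fun i hi => ?_
  rw [Finset.mem_symmDiff] at hi ⊢
  have hi' : i < u.length := by
    rcases hi with ⟨h', _⟩ | ⟨h', _⟩
    · exact lt_length_of_mem_supp h'
    · exact h ▸ lt_length_of_mem_supp h'
  simp only [mem_supp] at hi ⊢
  rwa [getD_append_of_lt hi', getD_append_of_lt (h ▸ hi')]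

theorem card_symmDiff_append_le (u v τ τ' : List Bool) (h : u.length = v.length)
    (h' : τ.length = τ'.length) :
    (symmDiff (supp (u ++ τ)) (supp (v ++ τ'))).card ≤
      (symmDiff (supp u) (supp v)).card + τ.length := by
  have hsub : symmDiff (supp (u ++ τ)) (supp (v ++ τ')) ⊆
      symmDiff (supp u) (supp v) ∪ Finset.Ico u.length (u.length + τ.length) := by
    intro i hi
    by_cases hiu : i < u.length
    · refine Finset.mem_union_left _ ?_
      rw [Finset.mem_symmDiff] at hi ⊢
      simp only [mem_supp] at hi ⊢
      rwa [getD_append_of_lt hiu, getD_append_of_lt (h ▸ hiu)] at hi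
    · refine Finset.mem_union_right _ (Finset.mem_Ico.2 ⟨not_lt.1 hiu, ?_⟩)
      rw [Finset.mem_symmDiff] at hi
      rcases hi with ⟨hi, _⟩ | ⟨hi, _⟩
      · simpa using lt_length_of_mem_supp hi
      · have := lt_length_of_mem_supp hi
        rwa [List.length_append, ← h, ← h'] at this
  refine (Finset.card_le_card hsub).trans ((Finset.card_union_le _ _).trans ?_)
  simp

/-! ### Unions of selected words -/

/-- Equal lengths and a sufficient supply of words are required because `List.zipWith` truncates to
the shorter argument. -/
theorem orRow_spec {n : ℕ} : ∀ (row : List Bool) (C : List (List Bool)) (zero : List Bool),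
    zero.length = n → (∀ w ∈ C, w.length = n) → row.length ≤ C.length →
    (orRow zero C row).length = n ∧ ∀ i, i ∈ supp (orRow zero C row) ↔
      i ∈ supp zero ∨ ∃ u, row.getD u false = true ∧ i ∈ supp (C.getD u [])
  | [], C, zero, hz, _, _ => ⟨hz, fun i => by simp [orRow]⟩
  | b :: row, [], zero, _, _, h => by simp at h
  | b :: row, w :: C, zero, hz, hC, h => by
    have hw : w.length = n := hC w (by simp)
    have hex : ∀ i, (∃ u, (b :: row).getD u false = true ∧ i ∈ supp ((w :: C).getD u [])) ↔
        (b = true ∧ i ∈ supp w) ∨ ∃ u, row.getD u false = true ∧ i ∈ supp (C.getD u []) := by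
      intro i
      constructor
      · rintro ⟨_ | u, h1, h2⟩
        · exact .inl ⟨by simpa using h1, by simpa using h2⟩
        · exact .inr ⟨u, by simpa using h1, by simpa using h2⟩
      · rintro (⟨h1, h2⟩ | ⟨u, h1, h2⟩)
        · exact ⟨0, by simpa using h1, by simpa using h2⟩
        · exact ⟨u + 1, by simpa using h1, by simpa using h2⟩
    simp only [hex]
    have hC' : ∀ w ∈ C, w.length = n := fun w' hw' => hC w' (by simp [hw'])
    have h' : row.length ≤ C.length := by simpa using h
    cases b
    · have := orRow_spec row C zero hz hC' h'
      refine ⟨this.1, fun i => ?_⟩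
      simp only [Bool.false_eq_true, false_and, false_or]
      exact this.2 i
    · have := orRow_spec row C (List.zipWith or zero w) (by simp [hz, hw]) hC' h'
      refine ⟨this.1, fun i => ?_⟩
      rw [← or_assoc, eq_self_iff_true, true_and, ← Finset.mem_union, ← supp_zipWith_or (hz.trans hw.symm)]
      exact this.2 i

/-! ### Words over an alphabet of unit vectors -/

theorem length_oneHot (q a : ℕ) : (oneHot q a).length = q := by simp [oneHot]

theorem supp_oneHot {q a : ℕ} (ha : a < q) : supp (oneHot q a) = {a} := by
  ext i
  rw [mem_supp, Finset.mem_singleton]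
  by_cases hi : i < q
  · simp [oneHot, List.getD_eq_getElem?_getD, hi]
  · have : i ≠ a := by omega
    simp [oneHot, List.getD_eq_getElem?_getD, hi, this]

theorem mem_blocks {q : ℕ} {w : List Bool} : w ∈ blocks q ↔ ∃ a < q, oneHot q a = w := by
  simp [blocks]

theorem length_of_mem_words_eq {Q : List (List Bool)} {N : ℕ} (hQ : ∀ a ∈ Q, a.length = N) :
    ∀ {n : ℕ} {w : List Bool}, w ∈ words Q n → w.length = n * N
  | 0, w, hw => by simp [words] at hw; simp [hw]
  | n + 1, w, hw => by
    simp only [words, List.mem_flatMap, List.mem_map] at hw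
    obtain ⟨a, ha, w', hw', rfl⟩ := hw
    have := length_of_mem_words_eq hQ hw'
    have := hQ a ha
    rw [List.length_append, add_mul]
    omega

theorem nodup_words {Q : List (List Bool)} {N : ℕ} (hQ : ∀ a ∈ Q, a.length = N) (hQ' : Q.Nodup) :
    ∀ n, (words Q n).Nodup
  | 0 => by simp [words]
  | n + 1 => by
    have : words Q (n + 1) = (Q ×ˢ words Q n).map fun p => p.1 ++ p.2 := by
      simp [words, List.product, SProd.sprod, List.map_flatMap, Function.comp_def]
    rw [this]
    refine List.Nodup.map_on ?_ (hQ'.product (nodup_words hQ hQ' n))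
    rintro ⟨a, w⟩ hp ⟨a', w'⟩ hp' h
    rw [List.mem_product] at hp hp'
    have := List.append_inj h ((hQ a hp.1).trans (hQ a' hp'.1).symm)
    exact Prod.ext this.1 this.2

theorem length_of_mem_words_blocks {q n : ℕ} {w : List Bool} (hw : w ∈ words (blocks q) n) :
    w.length = n * q :=
  length_of_mem_words_eq (fun a ha => by
    obtain ⟨i, _, rfl⟩ := mem_blocks.1 ha
    exact length_oneHot q i) hw

theorem card_supp_of_mem_words {q : ℕ} : ∀ {n : ℕ} {w : List Bool}, w ∈ words (blocks q) n →
    (supp w).card = n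
  | 0, w, hw => by simp [words] at hw; simp [hw, supp]
  | n + 1, w, hw => by
    simp only [words, List.mem_flatMap, List.mem_map] at hw
    obtain ⟨a, ha, w', hw', rfl⟩ := hw
    obtain ⟨i, hi, rfl⟩ := mem_blocks.1 ha
    have h1 := card_supp_of_mem_words hw'
    have h2 : (supp (oneHot q i)).card = 1 := by rw [supp_oneHot hi, Finset.card_singleton]
    rw [card_supp] at h1 h2 ⊢
    rw [List.count_append]
    omega

theorem agree_append {a b u v : List Bool} (h : a.length = b.length) :
    agree (a ++ u) (b ++ v) = agree a b + agree u v := by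
  simp [agree, List.zipWith_append h]

theorem agree_oneHot {q i j : ℕ} (hi : i < q) (hj : j < q) :
    agree (oneHot q i) (oneHot q j) = if i = j then 1 else 0 := by
  rw [agree_eq_card, supp_oneHot hi, supp_oneHot hj]
  split_ifs with h
  · simp [h]
  · simp [Finset.singleton_inter_of_notMem, h]

theorem sum_flatMap_eq {ι κ : Type} (l : List ι) (f : ι → List κ) (g : κ → ℕ) :
    ((l.flatMap f).map g).sum = (l.map fun a => ((f a).map g).sum).sum := by
  induction l with
  | nil => rfl
  | cons a l ih => simp [ih]

/-- The sum factors over the letters: in each place one letter agrees and contributes `q`, the other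
`q - 1` contribute `1`, in total at most `2 * q`. -/
theorem sum_pow_agree_le {q : ℕ} : ∀ {n : ℕ} {w : List Bool}, w ∈ words (blocks q) n →
    ((words (blocks q) n).map fun v => q ^ agree w v).sum ≤ (2 * q) ^ n
  | 0, w, hw => by simp [words] at hw ⊢; simp [hw, agree]
  | n + 1, w, hw => by
    simp only [words, List.mem_flatMap, List.mem_map] at hw
    obtain ⟨a, ha, w', hw', rfl⟩ := hw
    obtain ⟨i, hi, rfl⟩ := mem_blocks.1 ha
    have ih := sum_pow_agree_le hw'
    have h1 : ((words (blocks q) (n + 1)).map fun v => q ^ agree (oneHot q i ++ w') v).sum =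
        ((List.range q).map fun j => q ^ (if i = j then 1 else 0) *
          ((words (blocks q) n).map fun v => q ^ agree w' v).sum).sum := by
      simp only [words, blocks, List.flatMap_map]
      rw [sum_flatMap_eq]
      congr 1
      refine List.map_congr_left fun j hj => ?_
      rw [← List.sum_map_mul_left, List.map_map]
      congr 1
      refine List.map_congr_left fun v _ => ?_
      simp only [Function.comp_apply]
      rw [agree_append (by simp [length_oneHot]), agree_oneHot hi (List.mem_range.1 hj), pow_add]
    rw [h1, List.sum_map_mul_right, pow_succ']
    refine Nat.mul_le_mul ?_ ih
    have h2 : ((List.range q).map fun j => q ^ (if i = j then 1 else 0)).sum =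
        ∑ j ∈ Finset.range q, q ^ (if i = j then 1 else 0) := by
      rw [Finset.sum_range]
      simp [← List.sum_ofFn, List.ofFn_eq_map, ← List.map_coe_finRange_eq_range, Function.comp_def]
    rw [h2]
    calc ∑ j ∈ Finset.range q, q ^ (if i = j then 1 else 0)
        ≤ ∑ j ∈ Finset.range q, ((if i = j then q else 0) + 1) := by
          refine Finset.sum_le_sum fun j _ => ?_
          split_ifs <;> simp
      _ ≤ 2 * q := by
          rw [Finset.sum_add_distrib, Finset.sum_ite_eq]
          simp [hi]; omega

/-- Markov's inequality for the exponential moment: every word agreeing in at least `e` places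
contributes at least `q ^ e` to the sum. -/
theorem card_close_le {q n e : ℕ} {w : List Bool} (hq : 1 ≤ q) (hw : w ∈ words (blocks q) n) :
    ((words (blocks q) n).filter fun v => ¬ agree w v < e).length * q ^ e ≤ (2 * q) ^ n := by
  refine le_trans ?_ (sum_pow_agree_le hw)
  induction words (blocks q) n with
  | nil => simp
  | cons v W ih =>
    rw [List.map_cons, List.sum_cons]
    by_cases h : agree w v < e
    · rw [List.filter_cons_of_neg (by simpa using h)]
      omega
    · rw [List.filter_cons_of_pos (by simpa using h), List.length_cons, add_mul, one_mul]
      have := Nat.pow_le_pow_right hq (not_lt.1 h)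
      omega

/-! ### The greedy code -/

/-- Each pick discards at most `V` candidates, the picked word included thanks to `hself`. Hence a
candidate is left as long as `j * V` is less than the size of the pool, and every survivor is
compatible with all earlier picks. -/
theorem pick_iterate_spec {e m V : ℕ} {W : List (List Bool)} (hself : ∀ w ∈ W, e ≤ agree w w)
    (hV : ∀ w ∈ W, (W.filter fun v => ¬ agree w v < e).length ≤ V)
    (hm : ∀ j < m, j * V < W.length) : ∀ j ≤ m,
    ((pick e)^[j] (W, [])).1.Sublist W ∧ W.length ≤ ((pick e)^[j] (W, [])).1.length + j * V ∧
    ((pick e)^[j] (W, [])).2.length = j ∧ (∀ w ∈ ((pick e)^[j] (W, [])).2, w ∈ W) ∧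
    ((pick e)^[j] (W, [])).2.Pairwise (fun v w => agree w v < e) ∧
    ∀ v ∈ ((pick e)^[j] (W, [])).2, ∀ w ∈ ((pick e)^[j] (W, [])).1, agree v w < e := by
  intro j
  induction j with
  | zero => intro _; simp
  | succ j ih =>
    intro hj
    obtain ⟨h1, h2, h3, h4, h5, h6⟩ := ih (by omega)
    have hlt := hm j (by omega)
    rw [Function.iterate_succ_apply']
    generalize (pick e)^[j] (W, []) = s at *
    obtain ⟨U, C⟩ := s
    clear ih
    rcases U with _ | ⟨u, U⟩
    · simp at h2; omega
    have hu : u ∈ W := h1.subset (by simp)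
    have hnot : ((u :: U).filter fun v => ¬ agree u v < e).length ≤ V :=
      ((h1.filter _).length_le).trans (hV u hu)
    have hlen : (U.filter fun v => agree u v < e).length +
        ((u :: U).filter fun v => ¬ agree u v < e).length = (u :: U).length := by
      have h7 := List.length_eq_length_filter_add (l := u :: U) (fun v => decide (agree u v < e))
      rw [List.filter_cons_of_neg (by simpa using hself u hu)] at h7
      rw [h7]
      congr 3
      funext v
      exact decide_not
    have hsub : (U.filter fun v => agree u v < e).Sublist U := List.filter_sublist
    have hp : pick e (u :: U, C) = (U.filter fun v => agree u v < e, u :: C) := rfl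
    rw [hp]
    refine ⟨hsub.trans ((List.sublist_cons_self u U).trans h1), ?_, by simpa using h3, ?_, ?_, ?_⟩
    · dsimp only at h2 ⊢
      rw [add_mul]
      omega
    · intro w hw
      rcases List.mem_cons.1 hw with rfl | hw
      · exact hu
      · exact h4 w hw
    · exact List.Pairwise.cons (fun v hv => h6 v hv u (by simp)) h5
    · intro v hv w hw
      rcases List.mem_cons.1 hv with rfl | hv
      · exact of_decide_eq_true (List.mem_filter.1 hw).2
      · exact h6 v hv w (by simp [hsub.subset hw])

/-- There are `q ^ n` words, and a pick discards at most `(2 * q) ^ n / q ^ e`; the hypothesis `hm`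
is the comparison of the two after cancelling `q ^ n`. -/
theorem greedy_spec {q n e m : ℕ} (hq : 1 ≤ q) (he : e ≤ n)
    (hm : ∀ j < m, j * 2 ^ n < q ^ e) :
    (greedy e m (words (blocks q) n)).length = m ∧
    (∀ w ∈ greedy e m (words (blocks q) n), w ∈ words (blocks q) n) ∧
    (greedy e m (words (blocks q) n)).Pairwise (fun v w => agree w v < e) := by
  have h := pick_iterate_spec (e := e) (m := m) (V := (2 * q) ^ n / q ^ e)
    (W := words (blocks q) n)
    (fun w hw => by rw [agree_eq_card, Finset.inter_self, card_supp_of_mem_words hw]; exact he)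
    (fun w hw => (Nat.le_div_iff_mul_le (by positivity)).2 (card_close_le hq hw))
    (fun j hj => by
      rw [length_words, length_blocks]
      have h1 : (2 * q) ^ n / q ^ e * q ^ e ≤ (2 * q) ^ n := Nat.div_mul_le_self _ _
      have h2 := hm j hj
      have h3 : 0 < q ^ n := by positivity
      have h4 : j * ((2 * q) ^ n / q ^ e) * q ^ e < q ^ n * q ^ e := by
        calc j * ((2 * q) ^ n / q ^ e) * q ^ e = j * ((2 * q) ^ n / q ^ e * q ^ e) := by ring
          _ ≤ j * (2 * q) ^ n := Nat.mul_le_mul_left _ h1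
          _ = q ^ n * (j * 2 ^ n) := by rw [mul_pow]; ring
          _ < q ^ n * q ^ e := Nat.mul_lt_mul_of_pos_left h2 h3
      exact lt_of_mul_lt_mul_right h4 (Nat.zero_le _)) m le_rfl
  exact ⟨h.2.2.1, h.2.2.2.1, h.2.2.2.2.1⟩

theorem code_spec {M : ℕ} (hM : 1 ≤ M) (m : List Bool) :
    (code M m).length = m.length ∧
    (∀ w ∈ code M m, w.length = (codeLen M m).length) ∧
    (∀ w ∈ code M m, (supp w).card = M * (tagLen M m).length) ∧
    (code M m).Pairwise (fun v w => (supp w ∩ supp v).card ≤ (tagLen M m).length) := by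
  have hl := logUnary_spec m
  have hg : (logUnary m).length ≤ (tagLen M m).length := by
    rw [tagLen, length_rep]
    exact Nat.le_mul_of_pos_left _ hM
  have h := greedy_spec (q := 2 ^ (M + 1)) (n := (rep M (tagLen M m)).length)
    (e := (tagLen M m).length) (m := m.length) Nat.one_le_two_pow
    -- With `g` tag bits, `q = 2 ^ (M + 1)`, `n = M * g` and `e = g`, the condition on `j` reduces
    -- to `j < 2 ^ g`, which holds because `|m| ≤ 2 ^ g`.
    (by rw [length_rep]; exact Nat.le_mul_of_pos_left _ hM) (fun j hj => by
      rw [length_rep, ← pow_mul, add_mul, one_mul, pow_add, mul_comm]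
      have : j < 2 ^ (tagLen M m).length :=
        hj.trans_le (hl.2.1.trans (Nat.pow_le_pow_right (by norm_num) hg))
      exact Nat.mul_lt_mul_of_pos_left this (by positivity))
  refine ⟨h.1, fun w hw => ?_, fun w hw => ?_, h.2.2.imp fun {v w} hvw => ?_⟩
  · rw [length_of_mem_words_blocks (h.2.1 w hw), codeLen, length_rep (2 ^ (M + 1)), mul_comm]
  · rw [card_supp_of_mem_words (h.2.1 w hw), length_rep]
  · rw [← agree_eq_card]
    exact hvw.le

end JohnsonClustering

/-! ### Completeness and soundness of the constructed point set -/

namespace JohnsonClustering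
open Enc (enc)

/-! ### The instance produced by the reduction -/

/-- The characteristic vector of `T`. -/
def row {m : ℕ} (T : Finset (Fin m)) : List Bool := List.ofFn fun i => decide (i ∈ T)

/-- The number of tag bits for a universe of size `m`. -/
def tagBits (M m : ℕ) : ℕ := (tagLen M (List.replicate m true)).length

/-- The length of the code for a universe of size `m`. -/
def codeBits (M m : ℕ) : ℕ := (codeLen M (List.replicate m true)).length

/-- All tags. -/
def tags (M m : ℕ) : List (List Bool) := words [[true], [false]] (tagBits M m)

/-- The image of a set, without tag. -/
def phi (M : ℕ) {m : ℕ} (T : Finset (Fin m)) : List Bool :=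
  orRow (List.replicate (codeBits M m) false) (code M (List.replicate m true)) (row T)

/-- The support of the code word of `u`. -/
def codeSupp (M : ℕ) {m : ℕ} (u : Fin m) : Finset ℕ :=
  supp ((code M (List.replicate m true)).getD u [])

theorem codeBits_eq (M m : ℕ) : codeBits M m = 2 ^ (M + 1) * (M * tagBits M m) := by
  rw [codeBits, codeLen, length_rep, length_rep, tagBits]

theorem tagBits_spec {M : ℕ} (hM : 1 ≤ M) (m : ℕ) : 1 ≤ tagBits M m ∧
    ∃ l, tagBits M m = M * l ∧ m ≤ 2 ^ l := by
  obtain ⟨h1, h2, _⟩ := logUnary_spec (List.replicate m true)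
  rw [List.length_replicate] at h2
  rw [tagBits, tagLen, length_rep]
  exact ⟨Nat.mul_pos hM h1, _, rfl, h2⟩

variable {M m z : ℕ}

theorem code_length (hM : 1 ≤ M) : (code M (List.replicate m true)).length = m := by
  rw [(code_spec hM _).1, List.length_replicate]

theorem card_codeSupp (hM : 1 ≤ M) (u : Fin m) : (codeSupp M u).card = M * tagBits M m := by
  have hu : (u : ℕ) < (code M (List.replicate m true)).length := by
    rw [code_length hM]; exact u.2
  rw [codeSupp, List.getD_eq_getElem _ _ hu]
  exact (code_spec hM _).2.2.1 _ (List.getElem_mem hu)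

theorem card_codeSupp_inter (hM : 1 ≤ M) (u v : Fin m) (huv : u ≠ v) :
    (codeSupp M u ∩ codeSupp M v).card ≤ tagBits M m := by
  have hp := List.pairwise_iff_getElem.1 (code_spec hM (List.replicate m true)).2.2.2
  have hu : ∀ u : Fin m, (u : ℕ) < (code M (List.replicate m true)).length := fun u => by
    rw [code_length hM]; exact u.2
  rw [codeSupp, codeSupp, List.getD_eq_getElem _ _ (hu u), List.getD_eq_getElem _ _ (hu v)]
  rcases lt_or_gt_of_ne (Fin.val_ne_of_ne huv) with h | h
  · rw [Finset.inter_comm]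
    exact hp _ _ (hu u) (hu v) h
  · exact hp _ _ (hu v) (hu u) h

theorem phi_spec (hM : 1 ≤ M) (T : Finset (Fin m)) :
    (phi M T).length = codeBits M m ∧ supp (phi M T) = T.biUnion (codeSupp M) := by
  obtain ⟨h1, h2⟩ := orRow_spec (n := codeBits M m) (row T) (code M (List.replicate m true))
    (List.replicate (codeBits M m) false) (by simp) (code_spec hM _).2.1
    (by rw [code_length hM]; simp [row])
  refine ⟨h1, ?_⟩
  ext i
  rw [phi, h2, supp_replicate_false, Finset.mem_biUnion]
  simp only [Finset.notMem_empty, false_or]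
  constructor
  · rintro ⟨u, hu, hi⟩
    by_cases hum : u < m
    · refine ⟨⟨u, hum⟩, ?_, hi⟩
      simpa [row, hum] using hu
    · simp [row, hum] at hu
  · rintro ⟨u, hu, hi⟩
    exact ⟨u, by simpa [row] using hu, hi⟩

theorem card_symmDiff_phi_ge (hM : 1 ≤ M) (T T' : Finset (Fin m)) (hT : T.card = z)
    (hT' : T'.card = z) : 2 * (z - (T ∩ T').card) * ((M - 2 * z) * tagBits M m) ≤
      (symmDiff (supp (phi M T)) (supp (phi M T'))).card := by
  rw [(phi_spec hM T).2, (phi_spec hM T').2, Nat.sub_mul]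
  exact card_biUnion_symmDiff_ge _ (card_codeSupp hM) (card_codeSupp_inter hM) T T' hT hT'

theorem card_symmDiff_phi_le (hM : 1 ≤ M) {S T : Finset (Fin m)} (h : S ⊆ T) :
    (symmDiff (supp (phi M T)) (supp (phi M S))).card ≤
      (T.card - S.card) * (M * tagBits M m) := by
  rw [(phi_spec hM T).2, (phi_spec hM S).2]
  exact card_biUnion_symmDiff_le _ (card_codeSupp hM) h

theorem length_of_mem_tags {τ : List Bool} (h : τ ∈ tags M m) : τ.length = tagBits M m := by
  have := length_of_mem_words_eq (Q := [[true], [false]]) (N := 1) (by simp) h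
  simpa using this

theorem nodup_tags : (tags M m).Nodup :=
  nodup_words (Q := [[true], [false]]) (N := 1) (by simp) (by simp) _

/-- The point with code part `phi M T` and tag `τ`. -/
def point (M : ℕ) {m : ℕ} (T : Finset (Fin m)) (τ : List Bool) :
    Fin (codeBits M m + tagBits M m) → Bool := vec _ (phi M T ++ τ)

theorem length_point (hM : 1 ≤ M) (T : Finset (Fin m)) {τ : List Bool}
    (h : τ.length = tagBits M m) : (phi M T ++ τ).length = codeBits M m + tagBits M m := by
  rw [List.length_append, (phi_spec hM T).1, h]

theorem hammingDist_point_ge (hM : 1 ≤ M) (T T' : Finset (Fin m)) (hT : T.card = z)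
    (hT' : T'.card = z) {τ : List Bool} (h : τ.length = tagBits M m) :
    2 * (z - (T ∩ T').card) * ((M - 2 * z) * tagBits M m) ≤
      hammingDist (point M T τ) (point M T' τ) := by
  rw [point, point, hammingDist_vec (length_point hM T h) (length_point hM T' h)]
  refine (card_symmDiff_phi_ge hM T T' hT hT').trans (card_symmDiff_append_ge _ _ _ ?_)
  rw [(phi_spec hM T).1, (phi_spec hM T').1]

theorem hammingDist_point_le (hM : 1 ≤ M) {S T : Finset (Fin m)} (hS : S ⊆ T) {τ τ' : List Bool}
    (h : τ.length = tagBits M m) (h' : τ'.length = tagBits M m) :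
    hammingDist (point M T τ) (point M S τ') ≤
      ((T.card - S.card) * M + 1) * tagBits M m := by
  rw [point, point, hammingDist_vec (length_point hM T h) (length_point hM S h')]
  have h1 := card_symmDiff_append_le (phi M T) (phi M S) τ τ'
    (by rw [(phi_spec hM T).1, (phi_spec hM S).1]) (h.trans h'.symm)
  have h2 := card_symmDiff_phi_le hM hS
  rw [add_mul, one_mul, mul_assoc]
  omega

/-- Equal points have equal code parts, and since `M > 2 * z` and `g ≥ 1`, distance zero forces `|T
∩ T'| ≥ z`. -/
theorem point_injOn (hM : 2 * z < M) {T T' : Finset (Fin m)} (hT : T.card = z)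
    (hT' : T'.card = z) {τ τ' : List Bool} (h : τ.length = tagBits M m)
    (h' : τ'.length = tagBits M m) (heq : point M T τ = point M T' τ') : T = T' ∧ τ = τ' := by
  have hM1 : 1 ≤ M := by omega
  have h1 := vec_injOn (length_point hM1 T h) (length_point hM1 T' h') heq
  obtain ⟨h2, h3⟩ := List.append_inj h1 (by rw [(phi_spec hM1 T).1, (phi_spec hM1 T').1])
  refine ⟨?_, h3⟩
  have h4 := card_symmDiff_phi_ge hM1 T T' hT hT'
  rw [h2, symmDiff_self, Finset.bot_eq_empty, Finset.card_empty, Nat.le_zero, mul_eq_zero,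
    mul_eq_zero, mul_eq_zero] at h4
  have h5 := (tagBits_spec hM1 m).1
  have h6 : z ≤ (T ∩ T').card := by omega
  have h7 : T ∩ T' = T := Finset.eq_of_subset_of_card_le Finset.inter_subset_left (by omega)
  have h8 : T ∩ T' = T' := Finset.eq_of_subset_of_card_le Finset.inter_subset_right (by omega)
  exact h7.symm.trans h8

/-- The clustering instance for `I`. -/
def clustering (M : ℕ) (I : CoverageInstance) : ClusteringInstance where
  d := codeBits M I.n + tagBits M I.n
  P := (I.E ×ˢ (tags M I.n).toFinset).image fun p => point M p.1 p.2
  k := I.k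

variable {I : CoverageInstance}

theorem point_injOn_prod (hM : 2 * z < M) (hE : ∀ T ∈ I.E, T.card = z) :
    Set.InjOn (fun p : Finset (Fin I.n) × List Bool => point M p.1 p.2)
      (I.E ×ˢ (tags M I.n).toFinset : Finset _) := by
  rintro ⟨T, τ⟩ hp ⟨T', τ'⟩ hp' h
  simp only [Finset.coe_product, Set.mem_prod, Finset.mem_coe, List.mem_toFinset] at hp hp'
  have := point_injOn hM (hE T hp.1) (hE T' hp'.1) (length_of_mem_tags hp.2)
    (length_of_mem_tags hp'.2) h
  exact Prod.ext this.1 this.2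

theorem sum_clustering (hM : 2 * z < M) (hE : ∀ T ∈ I.E, T.card = z)
    (f : (Fin (clustering M I).d → Bool) → ℝ) :
    ∑ a ∈ (clustering M I).P, f a =
      ∑ τ ∈ (tags M I.n).toFinset, ∑ T ∈ I.E, f (point M T τ) := by
  exact (Finset.sum_image (f := f) (point_injOn_prod hM hE)).trans
    (Finset.sum_product_right _ _ _)

theorem card_clustering (hM : 2 * z < M) (hE : ∀ T ∈ I.E, T.card = z) :
    (clustering M I).P.card = I.E.card * 2 ^ tagBits M I.n := by
  rw [clustering, Finset.card_image_of_injOn (point_injOn_prod hM hE), Finset.card_product,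
    List.toFinset_card_of_nodup nodup_tags, tags, length_words]
  rfl

theorem encodedBy_clustering (hM : 2 * z < M) (hE : ∀ T ∈ I.E, T.card = z)
    {l : List (Finset (Fin I.n))} (hl : l.Nodup) (hlE : l.toFinset = I.E) :
    (clustering M I).EncodedBy (enc (reduce M ⟨I.n, I.k, l.map row⟩)) := by
  have hM1 : 1 ≤ M := by omega
  refine ⟨(l ×ˢ tags M I.n).map fun p => point M p.1 p.2, ?_, ?_, ?_⟩
  · refine List.Nodup.map_on (fun p hp q hq h => ?_) (hl.product nodup_tags)
    have hmem : ∀ p ∈ l ×ˢ tags M I.n, p ∈ I.E ×ˢ (tags M I.n).toFinset := fun p hp => by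
      obtain ⟨T, τ⟩ := p
      rw [List.mem_product] at hp
      simpa [← hlE] using hp
    exact point_injOn_prod hM hE (hmem p hp) (hmem q hq) h
  · have : ((l ×ˢ tags M I.n).map fun p => point M p.1 p.2).toFinset =
        (I.E ×ˢ (tags M I.n).toFinset).image fun p => point M p.1 p.2 := by
      ext a
      simp [← hlE]
    exact this
  · change encodeUnary _ ++ encodeUnary _ ++ (newRows M _ _).flatMap encodeRow =
      encodeUnary _ ++ encodeUnary _ ++ _
    congr 1
    have : newRows M (List.replicate I.n true) (l.map row) =
        (l ×ˢ tags M I.n).map fun p => phi M p.1 ++ p.2 := by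
      simp [newRows, List.product, SProd.sprod, List.map_flatMap, List.flatMap_map,
        Function.comp_def, phi, codeBits, tags, tagBits]
    change (newRows M (List.replicate I.n true) (l.map row)).flatMap encodeRow = _
    rw [this]
    refine (List.flatMap_map _ _ _).trans (Eq.trans ?_ (List.flatMap_map _ _ _).symm)
    refine List.flatMap_congr fun p hp => ?_
    obtain ⟨T, τ⟩ := p
    rw [List.mem_product] at hp
    congr 1
    exact (ofFn_vec (length_point hM1 T (length_of_mem_tags hp.2))).symm

/-- The centers are the images of the covering sets with the zero tag; any other tag costs at most
one more per tag bit. -/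
theorem clustering_complete {y t : ℕ} (hM : 2 * z < M) (hE : ∀ T ∈ I.E, T.card = z)
    (h : I.Complete y) :
    ∃ (c : Fin (clustering M I).k → (Fin (clustering M I).d → Bool))
      (σ : {a // a ∈ (clustering M I).P} → Fin (clustering M I).k),
      (clustering M I).cost t c σ ≤ (clustering M I).P.card *
        ((((z - y) * M + 1) * tagBits M I.n : ℕ) : ℝ) ^ t := by
  have hM1 : 1 ≤ M := by omega
  obtain ⟨S, hS, hcov⟩ := h
  set c : Fin I.k → (Fin (codeBits M I.n + tagBits M I.n) → Bool) :=
    fun i => point M (S i) (List.replicate (tagBits M I.n) false)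
  have hσ : ∀ a : {a // a ∈ (clustering M I).P}, ∃ i : Fin I.k,
      hammingDist a.1 (c i) ≤ ((z - y) * M + 1) * tagBits M I.n := by
    rintro ⟨a, ha⟩
    obtain ⟨⟨T, τ⟩, hp, rfl⟩ := Finset.mem_image.1 ha
    rw [Finset.mem_product, List.mem_toFinset] at hp
    have hT : T ∈ covUnion S I.E := by rw [hcov]; exact hp.1
    obtain ⟨i, _, hi⟩ := Finset.mem_biUnion.1 hT
    have := hammingDist_point_le hM1 (Finset.mem_filter.1 hi).2 (length_of_mem_tags hp.2)
      (List.length_replicate (n := tagBits M I.n) (a := false))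
    rw [hE T hp.1, hS i] at this
    exact ⟨i, this⟩
  choose σ hσ using hσ
  refine ⟨c, σ, ?_⟩
  have h1 : ∀ a ∈ Finset.univ, (hammingDist (a : {a // a ∈ (clustering M I).P}).1 (c (σ a)) : ℝ) ^ t ≤
      ((((z - y) * M + 1) * tagBits M I.n : ℕ) : ℝ) ^ t := fun a _ => by
    have := hσ a
    gcongr
  refine (Finset.sum_le_card_nsmul _ _ _ h1).trans_eq ?_
  rw [nsmul_eq_mul, Finset.card_univ, Fintype.card_coe]

/-- For a fixed tag the points form a copy of `E` to which `layer_cost_ge` applies, with the same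
centers for every tag; the bounds are summed over all tags. -/
theorem clustering_sound {y t : ℕ} (hyz : y < z) (hM : 2 * z < M) (hne : I.E.Nonempty)
    (hE : ∀ T ∈ I.E, T.card = z) {α κ : ℝ} (h : I.Sound α y)
    (hκ : ((I.k * (2 ^ z * z * I.n ^ (z - y - 1)) : ℕ) : ℝ) ≤ κ * I.E.card)
    (c : Fin (clustering M I).k → (Fin (clustering M I).d → Bool))
    (σ : {a // a ∈ (clustering M I).P} → Fin (clustering M I).k) :
    (((z - y : ℕ) + 1 : ℝ) ^ t - (((z - y : ℕ) + 1 : ℝ) ^ t - ((z - y : ℕ) : ℝ) ^ t) * (α + κ) -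
      ((z - y : ℕ) : ℝ) ^ t * κ) * (clustering M I).P.card *
      (((M - 2 * z) * tagBits M I.n : ℕ) : ℝ) ^ t ≤ (clustering M I).cost t c σ := by
  classical
  have hM1 : 1 ≤ M := by omega
  -- The distance to the assigned center is extended by `0` outside the point set, so that sums over
  -- the subtype become sums over a `Finset`.
  set r : (Fin (clustering M I).d → Bool) → ℕ := fun a =>
    if h : a ∈ (clustering M I).P then hammingDist a (c (σ ⟨a, h⟩)) else 0 with hr
  have hcost : (clustering M I).cost t c σ = ∑ a ∈ (clustering M I).P, (r a : ℝ) ^ t := by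
    rw [ClusteringInstance.cost, Finset.univ_eq_attach,
      ← Finset.sum_attach (clustering M I).P fun a => (r a : ℝ) ^ t]
    refine Finset.sum_congr rfl fun a _ => ?_
    simp [hr]
  have hlayer : ∀ τ ∈ (tags M I.n).toFinset,
      (((z - y : ℕ) + 1 : ℝ) ^ t - (((z - y : ℕ) + 1 : ℝ) ^ t - ((z - y : ℕ) : ℝ) ^ t) * (α + κ) -
      ((z - y : ℕ) : ℝ) ^ t * κ) * I.E.card *
      (((M - 2 * z) * tagBits M I.n : ℕ) : ℝ) ^ t ≤ ∑ T ∈ I.E, (r (point M T τ) : ℝ) ^ t :=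
    fun τ hτ => by
    rw [List.mem_toFinset] at hτ
    refine layer_cost_ge hyz I.E hne hE (fun T => point M T τ)
      (fun T hT T' hT' => hammingDist_point_ge hM1 T T' (hE T hT) (hE T' hT')
        (length_of_mem_tags hτ)) c h hκ (fun T => r (point M T τ)) fun T hT => ?_
    have hmem : point M T τ ∈ (clustering M I).P :=
      Finset.mem_image.2 ⟨(T, τ), by simpa using ⟨hT, hτ⟩, rfl⟩
    exact ⟨σ ⟨_, hmem⟩, dif_pos hmem⟩
  rw [hcost, sum_clustering hM hE]
  refine le_trans (le_of_eq ?_) (Finset.card_nsmul_le_sum _ _ _ hlayer)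
  rw [card_clustering hM hE, List.toFinset_card_of_nodup nodup_tags, tags, length_words,
    nsmul_eq_mul]
  simp only [List.length_cons, List.length_nil, zero_add, Nat.reduceAdd]
  push_cast
  ring

end JohnsonClustering

/-! ### From machines to `PT`, unique decoding, and short instances -/

namespace JohnsonClustering
open Enc (enc)

/-! ### Cleaning up and finite tables -/

/-- A number above all stacks that are mentioned. -/
def StackProg.bound : StackProg → ℕ
  | .skip => 0
  | .push r _ => r + 1
  | .pop r => r + 1
  | .seq p q => max p.bound q.bound
  | .branch r p q s => max (r + 1) (max p.bound (max q.bound s.bound))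
  | .loop r p => max (r + 1) p.bound

theorem Runs.eq_of_bound_le {p : StackProg} {s s' : Store} {t : ℕ} (h : Runs p s s' t) {i : ℕ}
    (hi : p.bound ≤ i) : s' i = s i := by
  induction h with
  | skip s => rfl
  | push r b s =>
    simp only [StackProg.bound] at hi
    exact Function.update_of_ne (by omega) _ _
  | pop r s =>
    simp only [StackProg.bound] at hi
    exact Function.update_of_ne (by omega) _ _
  | seq _ _ ih₁ ih₂ =>
    simp only [StackProg.bound, max_le_iff] at hi
    rw [ih₂ hi.2, ih₁ hi.1]
  | branchNil h _ ih =>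
    simp only [StackProg.bound, max_le_iff] at hi
    exact ih hi.2.1
  | branchFalse h _ ih =>
    simp only [StackProg.bound, max_le_iff] at hi
    exact ih hi.2.2.1
  | branchTrue h _ ih =>
    simp only [StackProg.bound, max_le_iff] at hi
    exact ih hi.2.2.2
  | loopDone h => rfl
  | loopStep h _ _ ih₁ ih₂ =>
    rw [ih₂ hi]
    simp only [StackProg.bound, max_le_iff] at hi
    exact ih₁ hi.2

/-- Empty the stacks `1`, …, `n`. -/
def clearAll : ℕ → StackProg
  | 0 => .skip
  | n + 1 => .seq (clearAll n) (clear (n + 1))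

theorem clearAll_runs {s : Store} {B : ℕ} (hB : ∀ i, (s i).length ≤ B) : ∀ n,
    RunsLe (clearAll n) s (fun i => if 1 ≤ i ∧ i ≤ n then [] else s i) (1 + n * (2 * B + 1))
  | 0 => by
    have : (fun i => if 1 ≤ i ∧ i ≤ 0 then [] else s i) = s := by
      funext i
      exact if_neg (by omega)
    rw [this]
    exact ⟨1, by simp, .skip s⟩
  | n + 1 => by
    have h1 := clearAll_runs hB n
    have h2 := clear_runs (n + 1) _ (fun i => if 1 ≤ i ∧ i ≤ n then [] else s i) rfl
    have e : Function.update (fun i => if 1 ≤ i ∧ i ≤ n then [] else s i) (n + 1) [] =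
        fun i => if 1 ≤ i ∧ i ≤ n + 1 then [] else s i := by
      funext i
      by_cases hi : i = n + 1
      · subst hi; simp
      · rw [Function.update_of_ne hi]
        exact if_congr (by omega) rfl rfl
    rw [e] at h2
    refine (h1.seq h2).mono ?_
    have := hB (n + 1)
    simp only [show ¬ (1 ≤ n + 1 ∧ n + 1 ≤ n) by omega, if_false]
    rw [add_mul]
    omega

/-- The definition permits leftovers on the work stacks. A program touches only stacks below
`bound`, and its running time limits their contents, so clearing them is cheap. -/
theorem PolyTimeComputable.pt {f : List Bool → List Bool} (hf : PolyTimeComputable f) : PT f := by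
  obtain ⟨p, b, h⟩ := hf
  refine .of_polyB (.seq p (clearAll p.bound))
    (T := fun x => b.eval (size x) + (1 + p.bound * (2 * (size x + b.eval (size x)) + 1)))
    ((PolyB.size.eval b).add ((PolyB.const 1).add ((PolyB.const _).mul
      (((PolyB.const 2).mul (PolyB.size.add (PolyB.size.eval b))).add (.const 1))))) fun x => ?_
  obtain ⟨s, t, hrun, hs, ht⟩ := h x
  rw [initStore_nil] at hrun
  have hB : ∀ i, (s i).length ≤ size x + b.eval (size x) := fun i => by
    have h1 := hrun.length_le i
    have h2 : (st [x] i).length ≤ x.length := by rcases i with _ | i <;> simp [st]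
    simp only [size_string]
    omega
  have h1 := clearAll_runs hB p.bound
  have e : (fun i => if 1 ≤ i ∧ i ≤ p.bound then [] else s i) = st [f x] := by
    funext i
    rcases i with _ | i
    · simp [st, hs]
    · by_cases hi : i + 1 ≤ p.bound
      · simp [st, hi]
      · rw [if_neg (by omega), hrun.eq_of_bound_le (by omega)]
        simp [st]
  rw [e] at h1
  exact RunsLe.seq ⟨t, ht, hrun⟩ h1

theorem PT.polyTimeComputable {f : List Bool → List Bool} (hf : PT f) : PolyTimeComputable f := by
  obtain ⟨p, b, h⟩ := hf
  refine ⟨p, b, fun x => ?_⟩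
  obtain ⟨t, ht, hrun⟩ := h x
  rw [initStore_nil]
  exact ⟨_, t, hrun, rfl, ht⟩

/-- Any function whatsoever, computable or not, can be tabulated on strings of bounded length by
branching on one bit at a time. -/
theorem PT.table (N : ℕ) : ∀ h : List Bool → List Bool,
    ∃ h' : List Bool → List Bool, PT h' ∧ ∀ x, x.length ≤ N → h' x = h x := by
  induction N with
  | zero =>
    intro h
    refine ⟨fun _ => h [], .const _, fun x hx => ?_⟩
    rw [List.length_eq_zero_iff.1 (Nat.le_zero.1 hx)]
  | succ N ih =>
    intro h
    obtain ⟨f, hf, hf'⟩ := ih fun x => h (false :: x)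
    obtain ⟨g, hg, hg'⟩ := ih fun x => h (true :: x)
    refine ⟨fun x => if x = [] then h [] else
      if (if x.head? = some true then [true] else []) = ([] : List Bool) then f x.tail
      else g x.tail,
      .ifNil .id (.const _) (.ifNil .headTrue (hf.comp .tail) (hg.comp .tail)), fun x hx => ?_⟩
    rcases x with _ | ⟨_ | _, x⟩
    · simp
    · simpa using hf' x (by simpa using hx)
    · simpa using hg' x (by simpa using hx)

theorem PT.dropConst : ∀ n : ℕ, PT (fun x : List Bool => x.drop n)
  | 0 => .id
  | n + 1 => by
    simpa only [List.tail_drop] using PT.tail.comp (PT.dropConst n)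

/-! ### Decoding -/

theorem encodeRow_append_inj : ∀ {a b u v : List Bool},
    encodeRow a ++ u = encodeRow b ++ v → a = b ∧ u = v
  | [], [], u, v, h => by simpa [encodeRow_nil] using h
  | [], _ :: _, u, v, h => by simp [encodeRow_nil, encodeRow_cons] at h
  | _ :: _, [], u, v, h => by simp [encodeRow_nil, encodeRow_cons] at h
  | c :: a, d :: b, u, v, h => by
    simp only [encodeRow_cons, List.cons_append, List.cons.injEq, true_and] at h
    obtain ⟨h1, h2⟩ := encodeRow_append_inj h.2
    exact ⟨by rw [h.1, h1], h2⟩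

theorem enc_list_injective : ∀ {l l' : List (List Bool)}, enc l = enc l' → l = l'
  | [], [], _ => rfl
  | [], _ :: _, h => by simp [enc_nil, enc_cons, encodeRow] at h
  | _ :: _, [], h => by simp [enc_nil, enc_cons, encodeRow] at h
  | w :: l, w' :: l', h => by
    rw [enc_cons, enc_cons] at h
    obtain ⟨h1, h2⟩ := encodeRow_append_inj h
    rw [h1, enc_list_injective h2]

theorem enc_rawInput_injective {r r' : RawInput} (h : enc r = enc r') : r = r' := by
  obtain ⟨m, k, l⟩ := r
  obtain ⟨m', k', l'⟩ := r'
  have e : ∀ (m k : ℕ) l, enc (RawInput.mk m k l) = encodeUnary m ++ (encodeUnary k ++ enc l) :=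
    fun m k l => List.append_assoc _ _ _
  rw [e, e] at h
  have h1 := congrArg splitUnary h
  rw [splitUnary_encode, splitUnary_encode, Prod.mk.injEq] at h1
  have h2 := congrArg splitUnary h1.2
  rw [splitUnary_encode, splitUnary_encode, Prod.mk.injEq] at h2
  have h3 := congrArg List.length h1.1
  have h4 := congrArg List.length h2.1
  have h5 := enc_list_injective h2.2
  simp only [List.length_replicate] at h3 h4
  rw [h3, h4, h5]

theorem row_injective {m : ℕ} : Function.Injective (row (m := m)) := by
  intro T T' h
  ext i
  have := congrFun (List.ofFn_injective h) i
  simpa using this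

theorem CoverageInstance.EncodedBy.exists_raw {I : CoverageInstance} {x : List Bool}
    (h : I.EncodedBy x) : ∃ l : List (Finset (Fin I.n)), l.Nodup ∧ l.toFinset = I.E ∧
      x = enc (RawInput.mk I.n I.k (l.map row)) := by
  obtain ⟨l, h1, h2, h3⟩ := h
  refine ⟨l, h1, h2, h3.trans ?_⟩
  change encodeUnary _ ++ encodeUnary _ ++ _ = encodeUnary _ ++ encodeUnary _ ++ _
  congr 1
  rw [List.flatMap_map, List.flatMap_map]
  rfl

/-- Uniqueness ensures that no string is a yes-input through one instance and a no-input through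
another. -/
theorem CoverageInstance.EncodedBy.unique {I I' : CoverageInstance} {x : List Bool}
    (h : I.EncodedBy x) (h' : I'.EncodedBy x) : I = I' := by
  obtain ⟨l, _, h1, h2⟩ := h.exists_raw
  obtain ⟨l', _, h1', h2'⟩ := h'.exists_raw
  obtain ⟨n, E, k⟩ := I
  obtain ⟨n', E', k'⟩ := I'
  have h3 := enc_rawInput_injective (h2.symm.trans h2')
  simp only [RawInput.mk.injEq] at h3
  obtain ⟨rfl, rfl, h3⟩ := h3
  have h4 := row_injective.list_map h3
  subst h4
  simp only at h1 h1'
  rw [← h1, ← h1']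

/-! ### Small instances -/

/-- With `k ≥ |E|` each member can be given its own `y`-subset, and superfluous indices repeat one
of them. -/
theorem CoverageInstance.complete_of_card_le {I : CoverageInstance} {z y : ℕ} (hyz : y < z)
    (hne : I.E.Nonempty) (hE : ∀ T ∈ I.E, T.card = z) (h : I.E.card ≤ I.k) : I.Complete y := by
  obtain ⟨T₀, hT₀⟩ := hne
  have hsub : ∀ T : {T // T ∈ I.E}, ∃ S : Finset (Fin I.n), S ⊆ T.1 ∧ S.card = y := fun T =>
    Finset.exists_subset_card_eq (by rw [hE T.1 T.2]; omega)
  choose S hS hSc using hsub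
  refine ⟨fun i => S (if h : (i : ℕ) < I.E.card then I.E.equivFin.symm ⟨i, h⟩ else ⟨T₀, hT₀⟩),
    fun i => hSc _, ?_⟩
  ext T
  simp only [covUnion, cov, Finset.mem_biUnion, Finset.mem_filter, Finset.mem_univ, true_and]
  constructor
  · rintro ⟨i, hT, _⟩
    exact hT
  · intro hT
    have hlt := (I.E.equivFin ⟨T, hT⟩).2
    refine ⟨⟨_, hlt.trans_le h⟩, hT, ?_⟩
    have := hS ⟨T, hT⟩
    simpa using this

theorem CoverageInstance.not_sound_of_complete {I : CoverageInstance} {α : ℝ} {y : ℕ} (hα : α < 1)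
    (hne : I.E.Nonempty) (h : I.Complete y) : ¬ I.Sound α y := by
  intro hs
  obtain ⟨S, hS, hcov⟩ := h
  have h1 := hs S hS
  rw [hcov] at h1
  have h2 : (0 : ℝ) < I.E.card := by exact_mod_cast hne.card_pos
  nlinarith

/-- Once `k` is bounded by `|E|`, a bound on the universe bounds the whole encoding; without this,
`k` in unary could be arbitrarily long. -/
theorem CoverageInstance.EncodedBy.length_le {I : CoverageInstance} {x : List Bool} {N : ℕ}
    (h : I.EncodedBy x) (hn : I.n ≤ N) (hk : I.k ≤ I.E.card) :
    x.length ≤ N + 1 + (2 ^ N + 1) + 2 ^ N * (2 * N + 1) := by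
  obtain ⟨l, h1, h2, rfl⟩ := h.exists_raw
  have hcard : I.E.card ≤ 2 ^ N := by
    refine (Finset.card_le_univ _).trans ?_
    rw [Fintype.card_finset, Fintype.card_fin]
    exact Nat.pow_le_pow_right (by norm_num) hn
  have hl : l.length = I.E.card := by rw [← h2, List.toFinset_card_of_nodup h1]
  have e : (enc (RawInput.mk I.n I.k (l.map row))).length =
      I.n + 1 + (I.k + 1) + size (l.map row) := by
    change (encodeUnary _ ++ encodeUnary _ ++ _).length = _
    simp only [List.length_append, encodeUnary, List.length_replicate, List.length_singleton]
    rfl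
  have h3 : size (l.map row) ≤ l.length * (2 * N + 1) := by
    have := size_le_of_forall_length_le (l := l.map row) (N := N) fun w hw => by
      obtain ⟨T, _, rfl⟩ := List.mem_map.1 hw
      simpa [row] using hn
    rwa [List.length_map] at this
  have h4 : l.length * (2 * N + 1) ≤ 2 ^ N * (2 * N + 1) :=
    Nat.mul_le_mul_right _ (hl ▸ hcard)
  omega

end JohnsonClustering

/-! ### Parameters and hardness of the gap problem -/

namespace JohnsonClustering
open Enc (enc)
open Filter Topology

/-! ### The choice of the parameter -/

/-- After division by `M ^ t` both sides are continuous in `1 / M`, and at `0` they differ by `ε * w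
^ t > 0`. -/
theorem exists_parameter (z t : ℕ) {w R γ ε : ℝ} (hw : 0 < w) (hε : 0 < ε) :
    ∃ M : ℕ, 2 * z < M ∧ (γ - ε) * ((w * M + 1) * (1 + z / M)) ^ t ≤
      w ^ t * (γ - (R + 1) / M) * (M - 2 * z) ^ t := by
  set F : ℝ → ℝ := fun x => w ^ t * (γ - (R + 1) * x) * (1 - 2 * z * x) ^ t -
    (γ - ε) * ((w + x) * (1 + z * x)) ^ t with hF
  have hcont : Continuous F := by fun_prop
  have h0 : 0 < F 0 := by
    have : F 0 = ε * w ^ t := by simp [hF]; ring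
    rw [this]; positivity
  have hlim := (hcont.tendsto 0).comp (tendsto_one_div_atTop_nhds_zero_nat (𝕜 := ℝ))
  obtain ⟨M, hpos, hM⟩ := ((hlim.eventually (lt_mem_nhds h0)).and
    (eventually_gt_atTop (2 * z))).exists
  refine ⟨M, hM, ?_⟩
  have hM0 : (0 : ℝ) < M := by exact_mod_cast (Nat.zero_le _).trans_lt hM
  have e1 : (w * M + 1) * (1 + z / M) = M * ((w + 1 / M) * (1 + z * (1 / M))) := by
    field_simp
  have e2 : (M : ℝ) - 2 * z = M * (1 - 2 * z * (1 / M)) := by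
    field_simp
  have e3 : (R + 1) / (M : ℝ) = (R + 1) * (1 / M) := by ring
  rw [e1, e2, e3, mul_pow (M : ℝ), mul_pow (M : ℝ)]
  have h1 : 0 ≤ (M : ℝ) ^ t * F (1 / M) := by
    have : 0 < F (1 / M) := hpos
    positivity
  simp only [hF] at h1
  nlinarith [h1]

/-! ### Fixed instances -/

theorem ClusteringInstance.exists_encodedBy (J : ClusteringInstance) : ∃ x, J.EncodedBy x :=
  ⟨_, J.P.toList, J.P.nodup_toList, J.P.toList_toFinset, rfl⟩

/-- All points of `{0,1}^1`, with `k` centers. -/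
def segment (k : ℕ) : ClusteringInstance := ⟨1, Finset.univ, k⟩

theorem card_segment (k : ℕ) : (segment k).P.card = 2 := by
  simp [segment]

theorem logDim_segment {k : ℕ} {D : ℝ} (hD : 1 ≤ D * Real.log 2) : (segment k).LogDim D := by
  rw [ClusteringInstance.LogDim, card_segment]
  exact ⟨le_rfl, by simpa [segment] using hD⟩

theorem segment_two_mem_yes {t : ℕ} (ht : t ≠ 0) {D ρ γ : ℝ} (hD : 1 ≤ D * Real.log 2)
    (hρ : 0 < ρ) {x : List Bool} (hx : (segment 2).EncodedBy x) :
    x ∈ (hammingClusteringGap t D ρ γ).yes := by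
  let c : Fin 2 → (Fin 1 → Bool) := fun i _ => decide (i = 1)
  let τ : (Fin 1 → Bool) → Fin 2 := fun a => if a 0 then 1 else 0
  refine ⟨segment 2, hx, logDim_segment hD, c, fun a => τ a.1, ?_⟩
  have key : ∀ a : Fin 1 → Bool, c (τ a) = a := by
    intro a
    funext i
    rw [Subsingleton.elim i 0]
    cases h : a 0 <;> simp [c, τ, h]
  have h0 : ∀ a : Fin 1 → Bool, (hammingDist a (c (τ a)) : ℝ) ^ t = 0 := fun a => by
    rw [key, hammingDist_self, Nat.cast_zero, zero_pow ht]
  have : (segment 2).cost t c (fun a => τ a.1) = 0 := Finset.sum_eq_zero fun a _ => h0 a.1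
  refine this.trans_le ?_
  have := Real.log_natCast_nonneg (segment 2).P.card
  positivity

theorem segment_zero_mem_no {t : ℕ} {D ρ γ : ℝ} (hD : 1 ≤ D * Real.log 2) {x : List Bool}
    (hx : (segment 0).EncodedBy x) : x ∈ (hammingClusteringGap t D ρ γ).no :=
  -- With points but no centers there is no assignment, so the condition holds vacuously.
  ⟨segment 0, hx, logDim_segment hD, fun _ σ =>
    (σ ⟨fun _ => true, Finset.mem_univ (α := Fin 1 → Bool) _⟩).elim0⟩

theorem cost_segment_one {t : ℕ} (ht : t ≠ 0)
    (c : Fin (segment 1).k → (Fin (segment 1).d → Bool))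
    (σ : {a // a ∈ (segment 1).P} → Fin (segment 1).k) : (segment 1).cost t c σ = 1 := by
  have h1 : (segment 1).cost t c σ =
      ∑ a : {a // a ∈ (segment 1).P}, (hammingDist a.1 (c (0 : Fin 1)) : ℝ) ^ t := by
    refine Finset.sum_congr rfl fun a _ => ?_
    rw [show σ a = (0 : Fin 1) from Subsingleton.elim (α := Fin 1) _ _]
  have h2 : ∑ a : {a // a ∈ (segment 1).P}, (hammingDist a.1 (c (0 : Fin 1)) : ℝ) ^ t =
      ∑ a : Fin 1 → Bool, (hammingDist a (c (0 : Fin 1)) : ℝ) ^ t :=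
    Finset.sum_attach (Finset.univ : Finset (Fin 1 → Bool))
      fun a => (hammingDist a (c (0 : Fin 1)) : ℝ) ^ t
  have key : ∀ v : Fin 1 → Bool, ∑ a : Fin 1 → Bool, (hammingDist a v : ℝ) ^ t = 1 := by
    intro v
    rw [← (Equiv.funUnique (Fin 1) Bool).symm.sum_comp, Fintype.sum_bool]
    have hd : ∀ b, hammingDist ((Equiv.funUnique (Fin 1) Bool).symm b) v =
        if b = v 0 then 0 else 1 := by
      intro b
      rw [hammingDist, Finset.card_filter]
      simp
    rw [hd, hd]
    cases v 0 <;> simp [ht]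
  exact h1.trans (h2.trans (key _))

theorem npHard_of_mem {Q : PromiseProblem} {x : List Bool} (h : x ∈ Q.yes) (h' : x ∈ Q.no) :
    NPHard Q := fun _ _ =>
  ⟨fun _ => x, (PT.const x).polyTimeComputable, fun _ _ => h, fun _ _ => h'⟩

/-! ### Estimates for the logarithm of the number of points -/

section Log

variable {M z : ℕ} {I : CoverageInstance}

theorem log_card_clustering_ge (hM : 2 * z < M) (hE : ∀ T ∈ I.E, T.card = z) (hne : I.E.Nonempty) :
    tagBits M I.n * Real.log 2 ≤ Real.log (clustering M I).P.card := by
  rw [← Real.log_pow]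
  refine Real.log_le_log (by positivity) ?_
  rw [card_clustering hM hE]
  push_cast
  have : (1 : ℝ) ≤ I.E.card := by exact_mod_cast hne.card_pos
  exact le_mul_of_one_le_left (by positivity) this

/-- With `g = M * l` and `m ≤ 2 ^ l`, the collection has at most `m ^ z ≤ 2 ^ (l * z)` members, and
`l * z` is only the fraction `z / M` of `g`: the tags dominate. -/
theorem log_card_clustering_le (hM : 2 * z < M) (hE : ∀ T ∈ I.E, T.card = z) (hne : I.E.Nonempty) :
    Real.log (clustering M I).P.card ≤ (1 + z / M) * (tagBits M I.n * Real.log 2) := by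
  have hM0 : (0 : ℝ) < M := by exact_mod_cast (Nat.zero_le _).trans_lt hM
  obtain ⟨l, hl, hml⟩ := (tagBits_spec (by omega : 1 ≤ M) I.n).2
  have hcard : I.E.card ≤ 2 ^ (l * z) := by
    have hsub : I.E ⊆ Finset.univ.powersetCard z := fun T hT =>
      Finset.mem_powersetCard.2 ⟨Finset.subset_univ _, hE T hT⟩
    refine (Finset.card_le_card hsub).trans ?_
    rw [Finset.card_powersetCard, Finset.card_fin, pow_mul]
    exact (Nat.choose_le_pow _ _).trans (Nat.pow_le_pow_left hml z)
  have h1 : ((clustering M I).P.card : ℝ) ≤ 2 ^ (l * z + tagBits M I.n) := by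
    rw [card_clustering hM hE, pow_add]
    push_cast
    gcongr
    exact_mod_cast hcard
  have h0 : (0 : ℝ) < (clustering M I).P.card := by
    rw [card_clustering hM hE]
    have := hne.card_pos
    positivity
  refine (Real.log_le_log h0 h1).trans_eq ?_
  rw [Real.log_pow, hl]
  push_cast
  field_simp
  ring

theorem logDim_clustering (hM : 2 * z < M) (hE : ∀ T ∈ I.E, T.card = z) (hne : I.E.Nonempty) :
    (clustering M I).LogDim ((2 ^ (M + 1) * M + 1) / Real.log 2) := by
  have hg := (tagBits_spec (by omega : 1 ≤ M) I.n).1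
  constructor
  · rw [card_clustering hM hE]
    have h1 := hne.card_pos
    have h2 : 2 ^ 1 ≤ 2 ^ tagBits M I.n := Nat.pow_le_pow_right (by norm_num) hg
    nlinarith
  · have hlog := Real.log_pos (by norm_num : (1 : ℝ) < 2)
    have h1 := log_card_clustering_ge hM hE hne
    have h2 : ((clustering M I).d : ℝ) =
        (2 ^ (M + 1) * M + 1) / Real.log 2 * (tagBits M I.n * Real.log 2) := by
      simp only [clustering, codeBits_eq]
      push_cast
      field_simp
    rw [h2]
    gcongr

end Log

/-! ### The gap -/

/-- The value of `ρ` is the completeness radius `((z - y) * M + 1) * g` divided by the lower bound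
`g * log 2` for `log n`, raised to the power `t`. -/
theorem clustering_mem_yes {M z y t : ℕ} {I : CoverageInstance} {γ : ℝ} (hM : 2 * z < M)
    (hE : ∀ T ∈ I.E, T.card = z) (hne : I.E.Nonempty) (h : I.Complete y) {x : List Bool}
    (hx : (clustering M I).EncodedBy x) :
    x ∈ (hammingClusteringGap t ((2 ^ (M + 1) * M + 1) / Real.log 2)
      ((((z - y : ℕ) * M + 1) / Real.log 2) ^ t) γ).yes := by
  obtain ⟨c, σ, hc⟩ := clustering_complete (t := t) hM hE h
  refine ⟨clustering M I, hx, logDim_clustering hM hE hne, c, σ, hc.trans ?_⟩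
  have hlog := Real.log_pos (by norm_num : (1 : ℝ) < 2)
  have h1 := log_card_clustering_ge hM hE hne
  rw [mul_comm _ ((clustering M I).P.card : ℝ), mul_assoc, ← mul_pow]
  gcongr
  calc ((((z - y) * M + 1) * tagBits M I.n : ℕ) : ℝ)
      = ((z - y : ℕ) * M + 1) / Real.log 2 * (tagBits M I.n * Real.log 2) := by
        push_cast; field_simp
    _ ≤ _ := by gcongr

theorem clustering_mem_no {M z y t : ℕ} {I : CoverageInstance} {α R ε : ℝ} (hyz : y < z)
    (hM : 2 * z < M)
    (hR : ((z - y : ℕ) : ℝ) ^ t * R = ((z - y : ℕ) + 1 : ℝ) ^ t - ((z - y : ℕ) : ℝ) ^ t)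
    (hgap : (1 + (1 - α) * R - ε) * ((((z - y : ℕ) : ℝ) * M + 1) * (1 + z / M)) ^ t ≤
      ((z - y : ℕ) : ℝ) ^ t * (1 + (1 - α) * R - (R + 1) / M) * (M - 2 * z) ^ t)
    (hE : ∀ T ∈ I.E, T.card = z) (hne : I.E.Nonempty) (h : I.Sound α y)
    (hκ : ((I.k * (2 ^ z * z * I.n ^ (z - y - 1)) : ℕ) : ℝ) ≤ 1 / M * I.E.card) {x : List Bool}
    (hx : (clustering M I).EncodedBy x) :
    x ∈ (hammingClusteringGap t ((2 ^ (M + 1) * M + 1) / Real.log 2)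
      ((((z - y : ℕ) * M + 1) / Real.log 2) ^ t) (1 + (1 - α) * R - ε)).no := by
  refine ⟨clustering M I, hx, logDim_clustering hM hE hne, fun c σ => ?_⟩
  have hlog := Real.log_pos (by norm_num : (1 : ℝ) < 2)
  have hlogP := Real.log_natCast_nonneg (clustering M I).P.card
  set γ := 1 + (1 - α) * R with hγ
  -- The upper bound for `log n` may only be multiplied by a nonnegative factor; for a negative one
  -- the claim is trivial.
  rcases lt_or_ge (γ - ε) 0 with hneg | hpos
  · have h1 : 0 ≤ (clustering M I).cost t c σ := by
      unfold ClusteringInstance.cost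
      positivity
    exact (mul_nonpos_of_nonpos_of_nonneg hneg.le (by positivity)).trans h1
  refine le_trans ?_ (clustering_sound (t := t) hyz hM hne hE h hκ c σ)
  have hM0 : (0 : ℝ) < M := by exact_mod_cast (Nat.zero_le _).trans_lt hM
  have h2 := log_card_clustering_le hM hE hne
  set w : ℝ := ((z - y : ℕ) : ℝ)
  set n : ℝ := ((clustering M I).P.card : ℝ)
  set g : ℝ := (tagBits M I.n : ℝ) with hg
  have hw : 0 ≤ w := Nat.cast_nonneg _
  have hcast : (((M - 2 * z) * tagBits M I.n : ℕ) : ℝ) = (M - 2 * z) * g := by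
    rw [Nat.cast_mul, Nat.cast_sub hM.le]; push_cast; rfl
  -- With error `κ = 1 / M` and `(w + 1) ^ t = w ^ t * (R + 1)`, the soundness coefficient is the
  -- ideal factor minus `(R + 1) / M`.
  have hcoef : (w + 1) ^ t - ((w + 1) ^ t - w ^ t) * (α + 1 / M) - w ^ t * (1 / M) =
      w ^ t * (γ - (R + 1) / M) := by
    rw [← hR, show (w + 1) ^ t = w ^ t * R + w ^ t by rw [hR]; ring, hγ]
    ring
  rw [hcast, hcoef, mul_pow]
  calc (γ - ε) * (((w * M + 1) / Real.log 2) ^ t * n * Real.log n ^ t)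
      ≤ (γ - ε) * (((w * M + 1) / Real.log 2) ^ t * n *
          ((1 + z / M) * (g * Real.log 2)) ^ t) := by gcongr
    _ = (γ - ε) * ((w * M + 1) * (1 + z / M)) ^ t * n * g ^ t := by
        have : ((w * M + 1) / Real.log 2) ^ t * ((1 + z / M) * (g * Real.log 2)) ^ t =
            ((w * M + 1) * (1 + z / M)) ^ t * g ^ t := by
          rw [← mul_pow, ← mul_pow]
          congr 1
          field_simp
        linear_combination (γ - ε) * n * this
    _ ≤ w ^ t * (γ - (R + 1) / M) * (M - 2 * z) ^ t * n * g ^ t := by gcongr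
    _ = w ^ t * (γ - (R + 1) / M) * n * ((M - 2 * z) ^ t * g ^ t) := by ring

theorem clusteringGap_npHard {α : ℝ} {z y t : ℕ} (hyz : y < z) (ht : t ≠ 0)
    (hJC : JohnsonCoverageStarNPHard α z y) {R ε : ℝ} (hε : 0 < ε)
    (hR : ((z - y : ℕ) : ℝ) ^ t * R = ((z - y : ℕ) + 1 : ℝ) ^ t - ((z - y : ℕ) : ℝ) ^ t) :
    ∃ D ρ : ℝ, 0 < ρ ∧ NPHard (hammingClusteringGap t D ρ (1 + (1 - α) * R - ε)) := by
  have hlog := Real.log_pos (by norm_num : (1 : ℝ) < 2)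
  have hw : (0 : ℝ) < ((z - y : ℕ) : ℝ) := by exact_mod_cast Nat.sub_pos_of_lt hyz
  have hR0 : 0 ≤ R := by
    have h1 : (0 : ℝ) ≤ ((z - y : ℕ) : ℝ) ^ t * R := by
      rw [hR]
      exact sub_nonneg.2 (pow_le_pow_left₀ hw.le (by linarith) t)
    exact nonneg_of_mul_nonneg_right h1 (by positivity)
  rcases le_or_gt 1 α with hα | hα
  -- The factor is at most `1`, and `ρ` is chosen so that the threshold equals `1`, the cost of
  -- every solution for the two points of `{0,1}^1` with one center.
  · refine ⟨1 / Real.log 2, 1 / (2 * Real.log 2 ^ t), by positivity, ?_⟩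
    have hD : (1 : ℝ) ≤ 1 / Real.log 2 * Real.log 2 := by rw [div_mul_cancel₀ _ hlog.ne']
    have hval : 1 / (2 * Real.log 2 ^ t) * ((segment 1).P.card : ℝ) *
        Real.log ((segment 1).P.card : ℝ) ^ t = 1 := by
      rw [card_segment]
      push_cast
      field_simp
    obtain ⟨x, hx⟩ := (segment 1).exists_encodedBy
    refine npHard_of_mem (x := x) ⟨segment 1, hx, logDim_segment hD, fun _ _ => true,
      fun _ => (0 : Fin 1), ?_⟩ ⟨segment 1, hx, logDim_segment hD, fun c σ => ?_⟩
    · exact (cost_segment_one ht _ _).trans_le hval.ge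
    · rw [cost_segment_one ht, hval]
      nlinarith
  obtain ⟨ω, hω, hhard⟩ := hJC
  obtain ⟨M, hM, hgap⟩ := exists_parameter z t (R := R) (γ := 1 + (1 - α) * R) hw hε
  have hM0 : (0 : ℝ) < M := by exact_mod_cast (Nat.zero_le _).trans_lt hM
  have hD : 1 ≤ (2 ^ (M + 1) * M + 1) / Real.log 2 * Real.log 2 := by
    rw [div_mul_cancel₀ _ hlog.ne', le_add_iff_nonneg_left]
    positivity
  have hρ : 0 < (((z - y : ℕ) * M + 1) / Real.log 2) ^ t := by positivity
  refine ⟨(2 ^ (M + 1) * M + 1) / Real.log 2, (((z - y : ℕ) * M + 1) / Real.log 2) ^ t, hρ,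
    fun L hL => ?_⟩
  obtain ⟨f, hf, hyes, hno⟩ := hhard L hL
  -- From `m₀` on, the density outweighs the exceptional families by the factor `M`, that is, `κ = 1
  -- / M` is admissible.
  obtain ⟨m₀, hm₀⟩ := (hω.eventually (eventually_ge_atTop
    ((M : ℝ) * (2 ^ z * z : ℕ)))).exists_forall_of_atTop
  set N := m₀ + 1 + (2 ^ m₀ + 1) + 2 ^ m₀ * (2 * m₀ + 1)
  obtain ⟨xy, hxy⟩ := (segment 2).exists_encodedBy
  obtain ⟨xn, hxn⟩ := (segment 0).exists_encodedBy
  classical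
  obtain ⟨T, hT, hTspec⟩ := PT.table N fun x =>
    if x ∈ (johnsonCoverage α z y ω).yes then xy else xn
  -- Both sides of the promise consist of encodings of instances, so every output of `f` can be
  -- parsed. The parse is picked by choice, but its encoding is the string `f x` itself.
  have hraw : ∀ x, ∃ r : RawInput, enc r = f x := by
    intro x
    by_cases hx : x ∈ L
    · obtain ⟨I, hI, _⟩ := hyes x hx
      obtain ⟨l, _, _, h⟩ := hI.exists_raw
      exact ⟨_, h.symm⟩
    · obtain ⟨I, hI, _⟩ := hno x hx
      obtain ⟨l, _, _, h⟩ := hI.exists_raw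
      exact ⟨_, h.symm⟩
  choose r hr using hraw
  have hf' := hf.pt
  have hrPT : PT r := hf'.of_enc (fun x => x) (fun _ => rfl) fun x => (hr x).symm
  have hencPT : PT (fun x => enc (reduce M (r x))) :=
    ((PT.reduce M).comp hrPT).of_enc (fun x => x) (fun _ => rfl) fun x => rfl
  have hencoded : ∀ {x : List Bool} {I : CoverageInstance}, I.EncodedBy (f x) →
      (∀ T ∈ I.E, T.card = z) → (clustering M I).EncodedBy (enc (reduce M (r x))) := by
    intro x I hI hE
    obtain ⟨l, h1, h2, h3⟩ := hI.exists_raw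
    rw [enc_rawInput_injective ((hr x).trans h3)]
    exact encodedBy_clustering hM hE h1 h2
  refine ⟨fun x => if (f x).drop N = [] then T (f x) else enc (reduce M (r x)),
    (PT.ifNil ((PT.dropConst N).comp hf') (hT.comp hf') hencPT).polyTimeComputable,
    fun x hx => ?_, fun x hx => ?_⟩
  · have hy := hyes x hx
    dsimp only
    split_ifs with hlen
    · rw [hTspec _ (List.drop_eq_nil_iff.1 hlen), if_pos hy]
      exact segment_two_mem_yes ht hD hρ hxy
    · obtain ⟨I, hI, ⟨hne, hE, _⟩, hc⟩ := hy
      exact clustering_mem_yes hM hE hne hc (hencoded hI hE)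
  · obtain ⟨I, hI, ⟨hne, hE, hdense⟩, hs⟩ := hno x hx
    dsimp only
    split_ifs with hlen
    · rw [hTspec _ (List.drop_eq_nil_iff.1 hlen), if_neg]
      · exact segment_zero_mem_no hD hxn
      · rintro ⟨I', hI', _, hc⟩
        rw [hI'.unique hI] at hc
        exact CoverageInstance.not_sound_of_complete hα hne hc hs
    -- A sound instance has `k ≤ |E|`, as it would be complete otherwise; with a universe smaller
    -- than `m₀` its encoding would fit into the table.
    · have hn : m₀ ≤ I.n := by
        by_contra! hlt
        have hk : I.k ≤ I.E.card := by
          by_contra! hk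
          exact CoverageInstance.not_sound_of_complete hα hne
            (CoverageInstance.complete_of_card_le hyz hne hE hk.le) hs
        exact hlen (List.drop_eq_nil_iff.2 (hI.length_le hlt.le hk))
      refine clustering_mem_no hyz hM hR hgap hE hne hs ?_ (hencoded hI hE)
      have h1 : (M : ℝ) * (2 ^ z * z : ℕ) * ((I.k : ℝ) * (I.n : ℝ) ^ (z - y - 1)) ≤ I.E.card :=
        (mul_le_mul_of_nonneg_right (hm₀ I.n hn) (by positivity)).trans hdense
      rw [one_div, ← div_eq_inv_mul, le_div_iff₀ hM0]
      refine le_trans (le_of_eq ?_) h1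
      push_cast
      ring

end JohnsonClustering

theorem mainTheorem6 (α : ℝ) (z y : ℕ) (hy : 1 ≤ y) (hyz : y < z)
    (hJC : JohnsonClustering.JohnsonCoverageStarNPHard α z y) (ε : ℝ) (hε : 0 < ε) :
    (∃ D ρ : ℝ, 0 < ρ ∧
      JohnsonClustering.NPHard (JohnsonClustering.hammingClusteringGap 1 D ρ
        (1 + (1 - α) / ((z : ℝ) - (y : ℝ)) - ε))) ∧
    (∃ D ρ : ℝ, 0 < ρ ∧
      JohnsonClustering.NPHard (JohnsonClustering.hammingClusteringGap 2 D ρ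
        (1 + (1 - α) * (2 * ((z : ℝ) - (y : ℝ)) + 1) / ((z : ℝ) - (y : ℝ)) ^ 2 - ε))) := by
  have hw : (0 : ℝ) < ((z - y : ℕ) : ℝ) := by exact_mod_cast Nat.sub_pos_of_lt hyz
  rw [← Nat.cast_sub hyz.le, div_eq_mul_one_div, mul_div_assoc]
  constructor
  -- For `t = 1` the relative increment is `R = 1 / w`, and for `t = 2` it is `R = (2 * w + 1) / w ^
  -- 2`, where `w = z - y`.
  · exact JohnsonClustering.clusteringGap_npHard hyz one_ne_zero hJC hε (by field_simp; ring)
  · exact JohnsonClustering.clusteringGap_npHard hyz two_ne_zero hJC hε (by field_simp; ring)
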